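/- Let $\alpha>1$. There is a constant $C>0$ depending only on $\alpha$ such that the following holds. Setting. Let $\mathcal X\subset\mathbb R^p$, $\mathcal Y\subset\mathbb R^q$ be compact and convex, $\mathcal Z=\mathcal X\times\mathcal Y$, with $\|\mathbf z-\mathbf z'\|\le D$ for all $\mathbf z,\mathbf z'\in\mathcal Z$, where $D>0$. Let $F=\frac1n\sum_{i=1}^nF_i$ with $n\ge1$ and each $F_i:\mathcal Z\to\mathbb R^{p+q}$ being $L$-Lipschitz continuous on $\mathcal Z$. Let $F$ be $\rho$-weakly monotone on $\mathcal Z$ with $0<\rho\le L$, i.e. $\langle F(\mathbf z)-F(\mathbf z'),\mathbf z-\mathbf z'\rangle\ge-\rho\|\mathbf z-\mathbf z'\|^2$. Assume that the Minty problem has a solution: there is $\mathbf z_*\in\mathcal Z$ with $\langle F(\mathbf z),\mathbf z-\mathbf z_*\rangle\ge0$ for all $\mathbf z\in\mathcal Z$. For $\mathbf w\in\mathcal Z$ put $F^\gamma_{\mathbf w}(\mathbf z)=F(\mathbf z)+\frac1\gamma(\mathbf z-\mathbf w)$; $\mathrm{SVI}(G,\mathcal Z)$ is the problem of finding $\bar{\mathbf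 z}\in\mathcal Z$ with $\langle G(\bar{\mathbf z}),\mathbf z-\bar{\mathbf z}\rangle\ge0$ for all $\mathbf z\in\mathcal Z$. Inner solver. For $G=\frac1n\sum_iG_i$, parameters $\mu,\Lambda>0$, a reference point $\mathbf w$, a starting point $\mathbf w^{(0)}\in\mathcal Z$ and $T$ epochs, SVRG sets $\eta=\mu/(4(\Lambda+\mu)^2)$, $S=\lceil4\log(4)(\Lambda+\mu)^2/\mu^2\rceil$, $A(\mathbf z)=\mu(\mathbf z-\mathbf w)+N_{\mathcal Z}(\mathbf z)$ ($N_{\mathcal Z}$ the normal cone), $B(\mathbf z)=G(\mathbf z)-\mu(\mathbf z-\mathbf w)$, $B_i(\mathbf z)=\frac1nG_i(\mathbf z)-\frac\mu n(\mathbf z-\mathbf w)$. For $t=0,\dots,T-1$ it computes $B(\mathbf w^{(t)})$, sets $\mathbf z^{(0)}=\mathbf w^{(t)}$, for $s=0,\dots,S-1$ draws $i$ uniformly from $\{1,\dots,n\}$ and sets $\mathbf z^{(s+1)}=(I+\eta A)^{-1}\big(\mathbf z^{(s)}-\eta[B(\mathbf w^{(t)})-nB_i(\mathbf w^{(t)})+nB_i(\mathbf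 z^{(s)})]\big)$, and puts $\mathbf w^{(t+1)}=\mathbf z^{(S)}$. It returns $\mathrm{Proj}_{\mathcal Z}\big(\mathbf w^{(T)}-G(\mathbf w^{(T)})/(\sqrt2\Lambda)\big)$. Inexact proximal point method. Let $\epsilon>0$, $\gamma=1/(2\rho)$, $K=\lceil6D^2(\alpha+1)/\epsilon^2\rceil$, $\mathbf z_0\in\mathcal Z$ and $T_k=\big\lceil(1-\sqrt3/2)^{-1}\log\big((2+\sqrt2)L(k+1)/\rho\big)\big\rceil$. For $k=0,\dots,K-1$ let $\mathbf z_{k+1}$ be the result of SVRG with $T_k$ epochs started at $\mathbf z_k$ on $G_i(\mathbf z)=F_i(\mathbf z)+\frac1\gamma(\mathbf z-\mathbf z_k)$, with $\mu=\frac1\gamma-\rho=\rho$, $\Lambda=L+\frac1\gamma=L+2\rho$ and any reference point, which may depend on $k$ and $\mathbf z_k$. The output is $\mathbf z_\tau$, where $\tau\in\{0,\dots,K-1\}$ is drawn independently with $\mathrm{Prob}(\tau=k)=(k+1)^\alpha/\sum_{l=0}^{K-1}(l+1)^\alpha$. Conclusion. For every $\mathbf w\in\mathcal Z$ the problem $\mathrm{SVI}(F^\gamma_{\mathbf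 w},\mathcal Z)$ has a unique solution; the output satisfies $\mathbf z_\tau\in\mathcal Z$ and, with $\bar{\mathbf z}_\tau=(\bar{\mathbf u}_\tau,\bar{\mathbf v}_\tau)$ the solution of $\mathrm{SVI}(F^\gamma_{\mathbf z_\tau},\mathcal Z)$, $$\mathbb E\|\mathbf z_\tau-\bar{\mathbf z}_\tau\|^2\le\epsilon^2 .$$ If moreover $F$ is the map of a min-max problem $\min_{\mathbf x\in\mathcal X}\max_{\mathbf y\in\mathcal Y}f(\mathbf x,\mathbf y)$ with $f:\mathbb R^p\times\mathbb R^q\to\mathbb R$, i.e. $\partial_xf(\mathbf x,\mathbf y)\times\partial_y[-f(\mathbf x,\mathbf y)]=\{F(\mathbf x,\mathbf y)\}$ on $\mathcal Z$ (Fréchet subdifferentials), then $$\mathbb E\big[\mathrm{dist}^2\big(0,\ \partial_x[f+1_{\mathcal X}](\bar{\mathbf u}_\tau,\bar{\mathbf v}_\tau)\times\partial_y[-f+1_{\mathcal Y}](\bar{\mathbf u}_\tau,\bar{\mathbf v}_\tau)\big)\big]\le\epsilon^2/\gamma^2 ,$$ where $1_{\mathcal X},1_{\mathcal Y}$ are the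 $\{0,+\infty\}$-valued indicator functions. The total gradient complexity, i.e. the number of evaluations of the $F_i$ in all $K$ stages, is $\widetilde O\big(D^2(n+L^2/\rho^2)/\epsilon^2\big)$: if $\epsilon\le D$, it is in every run at most $$C\,\frac{D^2(n+L^2/\rho^2)}{\epsilon^2}\Big(1+\log\frac L\rho+\log\frac D\epsilon\Big).$$ -/

import Mathlib

open scoped ENNReal Topology

noncomputable section

namespace IPP

/-! ### Randomized first-order programs

A program can access the finite-sum map `F = (1/n) ∑ i, F i` only through queries `F i z`
(gradient evaluations) and can draw random indices from explicitly given laws. -/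

/-- Randomized programs over the oracle `(i, z) ↦ F i z`, with result in `α`. -/
inductive Prog (n : ℕ) (E : Type) (α : Type) : Type
  | ret : α → Prog n E α
  | query : Fin n → E → (E → Prog n E α) → Prog n E α
  | draw : (m : ℕ) → PMF (Fin m) → (Fin m → Prog n E α) → Prog n E α

namespace Prog

variable {n : ℕ} {E : Type} {α β : Type}

/-- Sequential composition. -/
def bind : Prog n E α → (α → Prog n E β) → Prog n E β
  | ret a, f => f a
  | query i z k, f => query i z (fun g => (k g).bind f)
  | draw m p k, f => draw m p (fun j => (k j).bind f)

instance : Monad (Prog n E) where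
  pure := ret
  bind := bind

/-- Evaluate the `i`-th component map at `z`. -/
def eval (i : Fin n) (z : E) : Prog n E E := query i z ret

/-- Draw an index with law `p`. -/
def sample {m : ℕ} (p : PMF (Fin m)) : Prog n E (Fin m) := draw m p ret

/-- Joint law of the result of a program and of the number of oracle queries it made, when the
queries are answered by the component maps `F i` and all draws are independent. -/
def run (F : Fin n → E → E) : Prog n E α → PMF (α × ℕ)
  | ret a => PMF.pure (a, 0)
  | query i z k => ((k (F i z)).run F).map (fun o => (o.1, o.2 + 1))
  | draw _ p k => p.bind (fun j => (k j).run F)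

end Prog

/-- Expectation of a nonnegative quantity under a discrete law. -/
def expect {Ω : Type} (P : PMF Ω) (g : Ω → ℝ≥0∞) : ℝ≥0∞ := ∑' o, P o * g o

/-! ### Variational inequalities, projections, resolvents -/

section VI

variable {E : Type} [NormedAddCommGroup E] [InnerProductSpace ℝ E]

/-- `ρ`-weak monotonicity on `Z`. -/
def WeaklyMonotoneOn (ρ : ℝ) (F : E → E) (Z : Set E) : Prop :=
  ∀ z ∈ Z, ∀ z' ∈ Z, -ρ * ‖z - z'‖ ^ 2 ≤ inner ℝ (F z - F z') (z - z')

/-- Solutions of the Stampacchia variational inequality `SVI(F, Z)`. -/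
def IsSVISolution (F : E → E) (Z : Set E) (zs : E) : Prop :=
  zs ∈ Z ∧ ∀ z ∈ Z, 0 ≤ inner ℝ (F zs) (z - zs)

/-- Solutions of the Minty variational inequality `MVI(F, Z)`. -/
def IsMVISolution (F : E → E) (Z : Set E) (zs : E) : Prop :=
  zs ∈ Z ∧ ∀ z ∈ Z, 0 ≤ inner ℝ (F z) (z - zs)

/-- The proximal-point mapping `F_w^γ (z) = F z + γ⁻¹ (z - w)`. -/
def proxMap (F : E → E) (γ : ℝ) (w z : E) : E := F z + γ⁻¹ • (z - w)

/-- The finite-sum map `(1/n) ∑ i, F i`. -/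
def avg {n : ℕ} (F : Fin n → E → E) (z : E) : E := (n : ℝ)⁻¹ • ∑ i, F i z

/-- Euclidean projection onto `Z`. -/
def proj (Z : Set E) (z : E) : E :=
  Classical.epsilon (fun p => p ∈ Z ∧ ∀ y ∈ Z, ‖z - p‖ ≤ ‖z - y‖)

/-- Normal cone of `Z` at `z`, i.e. the subdifferential at `z` of the indicator of `Z`. -/
def normalCone (Z : Set E) (z : E) : Set E :=
  {v | z ∈ Z ∧ ∀ y ∈ Z, inner ℝ v (y - z) ≤ 0}

/-- The set-valued map `A(z) = μ (z - w) + ∂1_Z(z)`. -/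
def opA (μ : ℝ) (w : E) (Z : Set E) (z : E) : Set E :=
  {a | ∃ v ∈ normalCone Z z, a = μ • (z - w) + v}

/-- The resolvent `(I + η A)⁻¹`. -/
def resolvent (η : ℝ) (A : E → Set E) (z : E) : E :=
  Classical.epsilon (fun p => ∃ a ∈ A p, p + η • a = z)

/-! ### The SVRG forward-backward method with an extra projection step

The component maps of the problem to be solved are passed as a family `G` of programs. -/

variable {n : ℕ}

/-- Sum of the components in a list, evaluated one by one. -/
def sumComponents (G : Fin n → E → Prog n E E) (z : E) : List (Fin n) → Prog n E E
  | [] => pure 0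
  | i :: l => do
    let g ← G i z
    let s ← sumComponents G z l
    pure (g + s)

/-- Evaluation of the full map `(1/n) ∑ i, G i`, by evaluating all `n` components. -/
def fullMap (G : Fin n → E → Prog n E E) (z : E) : Prog n E E := do
  let s ← sumComponents G z (List.finRange n)
  pure ((n : ℝ)⁻¹ • s)

/-- `B_i(z) = (1/n) F_i(z) - (μ/n) (z - w)`, as a function of `z` and of the value `g = F_i(z)`. -/
def compB (n : ℕ) (μ : ℝ) (w z g : E) : E := (n : ℝ)⁻¹ • g - (μ / n) • (z - w)

/-- The inner loop: `s` further steps from `z`, with snapshot `wt` and `Bbar = B(wt)`. -/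
def svrgInner [NeZero n] (G : Fin n → E → Prog n E E) (Z : Set E) (μ η : ℝ) (w wt Bbar : E) :
    ℕ → E → Prog n E E
  | 0, z => pure z
  | s + 1, z => do
    let i ← Prog.sample (PMF.uniformOfFintype (Fin n))
    let gw ← G i wt
    let gz ← G i z
    let Bs := Bbar - (n : ℝ) • compB n μ w wt gw + (n : ℝ) • compB n μ w z gz
    svrgInner G Z μ η w wt Bbar s (resolvent η (opA μ w Z) (z - η • Bs))

/-- The outer loop: `t` further epochs of `S` inner steps each, from the snapshot `wt`. -/
def svrgOuter [NeZero n] (G : Fin n → E → Prog n E E) (Z : Set E) (μ η : ℝ) (S : ℕ) (w : E) :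
    ℕ → E → Prog n E E
  | 0, wt => pure wt
  | t + 1, wt => do
    let Fwt ← fullMap G wt
    let wt' ← svrgInner G Z μ η w wt (Fwt - μ • (wt - w)) S wt
    svrgOuter G Z μ η S w t wt'

/-- The SVRG method for a `μ`-strongly monotone variational inequality over `Z` whose components
`G i` are `Lip`-Lipschitz, with reference point `w`, starting point `w0` and `T` epochs, followed
by one projected step. -/
def svrg [NeZero n] (G : Fin n → E → Prog n E E) (Z : Set E) (μ Lip : ℝ) (w w0 : E) (T : ℕ) :
    Prog n E E := do
  let wT ← svrgOuter G Z μ (μ / (4 * (Lip + μ) ^ 2))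
    ⌈4 * Real.log 4 * (Lip + μ) ^ 2 / μ ^ 2⌉₊ w T w0
  let g ← fullMap G wT
  pure (proj Z (wT - (√2 * Lip)⁻¹ • g))

/-! ### The inexact proximal point method -/

/-- `K` stages `z_{k+1} = ApproxSVI_k(z_k)`; the result `h` has `h k = z_k` for `k ≤ K`. -/
def ippLoop (approx : ℕ → E → Prog n E E) (z0 : E) : ℕ → Prog n E (ℕ → E)
  | 0 => pure (fun _ => z0)
  | k + 1 => do
    let h ← ippLoop approx z0 k
    let z' ← approx k (h k)
    pure (Function.update h (k + 1) z')

/-- The law on `{0, …, K-1}` with `Prob(τ = k) = (k+1)^α / ∑ l < K, (l+1)^α`. -/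
def stageLaw (α : ℝ) (K : ℕ) [NeZero K] : PMF (Fin K) :=
  PMF.normalize (fun k : Fin K => ENNReal.ofReal (((k : ℕ) + 1 : ℝ) ^ α))
    (by
      intro h
      have h0 := ENNReal.tsum_eq_zero.mp h (0 : Fin K)
      rw [ENNReal.ofReal_eq_zero] at h0
      exact absurd h0 (not_le.mpr (by positivity)))
    (by
      rw [tsum_fintype]
      exact ENNReal.sum_ne_top.mpr (fun _ _ => ENNReal.ofReal_ne_top))

/-- The inexact proximal point method: `K` stages, then output of `z_τ` for a random `τ`. -/
def ipp {K : ℕ} (approx : ℕ → E → Prog n E E) (τLaw : PMF (Fin K)) (z0 : E) : Prog n E E := do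
  let h ← ippLoop approx z0 K
  let τ ← Prog.sample τLaw
  pure (h (τ : ℕ))

/-- Components of the proximal-point mapping: `F_i(z) + γ⁻¹ (z - w)`, at the price of one query. -/
def proxComponent (γ : ℝ) (w : E) (i : Fin n) (z : E) : Prog n E E := do
  let g ← Prog.eval i z
  pure (g + γ⁻¹ • (z - w))

/-- Inexact proximal point method with SVRG as inner solver, for a `ρ`-weakly monotone finite sum
with `L`-Lipschitz components: stage `k` runs `T k` epochs of SVRG from `z_k` on `F_{z_k}^γ`, which
is `(γ⁻¹ - ρ)`-strongly monotone with `(L + γ⁻¹)`-Lipschitz components. The reference point of SVRG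
may be any function `ref k z_k` of the stage and of the proximal center. -/
def ippSVRG [NeZero n] {K : ℕ} (Z : Set E) (γ ρ L : ℝ) (T : ℕ → ℕ) (τLaw : PMF (Fin K))
    (ref : ℕ → E → E) (z0 : E) : Prog n E E :=
  ipp (fun k zk => svrg (proxComponent γ zk) Z (γ⁻¹ - ρ) (L + γ⁻¹) (ref k zk) zk (T k)) τLaw z0

/-! ### Fréchet subdifferentials and saddle-point problems -/

/-- Fréchet subdifferential of `h : E → ℝ ∪ {+∞}` at `x`. -/
def frechetSubdiff (h : E → WithTop ℝ) (x : E) : Set E :=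
  {ζ | h x ≠ ⊤ ∧ ∀ δ : ℝ, 0 < δ → ∀ᶠ x' in 𝓝 x,
    h x + ((inner ℝ ζ (x' - x) - δ * ‖x' - x‖ : ℝ) : WithTop ℝ) ≤ h x'}

open Classical in
/-- The indicator function `1_S`, equal to `0` on `S` and to `+∞` outside `S`. -/
def indicatorTop (S : Set E) (x : E) : WithTop ℝ := if x ∈ S then 0 else ⊤

end VI

/-- `ℝ^p`. -/
abbrev Vec (p : ℕ) : Type := EuclideanSpace ℝ (Fin p)

/-- `ℝ^p × ℝ^q` with the Euclidean norm. -/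
abbrev Pair (p q : ℕ) : Type := WithLp 2 (Vec p × Vec q)

/-- The feasible set `X × Y`. -/
def feasible {p q : ℕ} (X : Set (Vec p)) (Y : Set (Vec q)) : Set (Pair p q) :=
  {z | z.fst ∈ X ∧ z.snd ∈ Y}

/-- The set-valued map `z = (x, y) ↦ ∂_x f(x, y) × ∂_y[-f(x, y)]` of `min_x max_y f(x, y)`. -/
def saddleMap {p q : ℕ} (f : Vec p → Vec q → ℝ) (z : Pair p q) : Set (Pair p q) :=
  {ξ | ξ.fst ∈ frechetSubdiff (fun x => ((f x z.snd : ℝ) : WithTop ℝ)) z.fst ∧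
    ξ.snd ∈ frechetSubdiff (fun y => ((-f z.fst y : ℝ) : WithTop ℝ)) z.snd}

/-- The set `∂_x[f(x, y) + 1_X(x)] × ∂_y[-f(x, y) + 1_Y(y)]` at `z = (x, y)`. -/
def constrainedSubdiff {p q : ℕ} (f : Vec p → Vec q → ℝ) (X : Set (Vec p)) (Y : Set (Vec q))
    (z : Pair p q) : Set (Pair p q) :=
  {ξ | ξ.fst ∈ frechetSubdiff (fun x => ((f x z.snd : ℝ) : WithTop ℝ) + indicatorTop X x) z.fst ∧
    ξ.snd ∈ frechetSubdiff (fun y => ((-f z.fst y : ℝ) : WithTop ℝ) + indicatorTop Y y) z.snd}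

end IPP

end

noncomputable section

namespace IPP

/-! ### Calculus of expectations and sure bounds for randomized programs -/

section


namespace Prog

variable {n : ℕ} {E α β : Type}

/-! Write `bar w` for the exact proximal point, the solution of the variational inequality of
`proxMap (avg F) γ w`. Since γ⁻¹ = 2ρ, that map is ρ-strongly monotone and Lipschitz, so `bar w`
exists and is unique by Banach's theorem for a projected step. Three estimates carry the proof.

Inner solver. The solution is a fixed point of the forward-backward step. The resolvent contracts by
1/(1+ημ), the forward map is monotone, and the noise of the unbiased gradient estimate is at most
(Λ+μ)² times the squared distance from the iterate to the snapshot (`svrg_step`). Each epoch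
therefore multiplies the mean squared error by 3/4, and T_k epochs bring it below ‖z - bar
z‖²/(4(k+1)²).

Outer loop. An exact proximal step moves closer to the Minty solution zs: ‖bar z - zs‖² + ‖z - bar
z‖² ≤ ‖z - zs‖². Young's inequality with parameter 1/(k+1) makes the inexactness cost only D²/(k+1)
(`mean_stage_le`). Weighting stage k by (k+1)^α and telescoping (`mean_ippLoop_potential_le`) bounds
the weighted sum of the ‖z_k - bar z_k‖² by a multiple of K^α D². The weights sum to at least
K^(α+1)/(α+1), so the average is at most 4(α+1)D²/K ≤ ε².

Stationarity. The vector γ⁻¹(w - bar w) is the value of `avg F` at `bar w` plus a normal vector,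
hence a constrained subgradient, so the distance to 0 is at most γ⁻¹‖w - bar w‖.

Probability is handled by structural recursion on programs: `mean` for expectations, `Post` for what
holds in every run (feasibility and the exact query count), and `Returns` for deterministic
subprograms. -/

/-- Real-valued expectation of a function of the result of a program. -/
def mean (F : Fin n → E → E) : Prog n E α → (α → ℝ) → ℝ
  | ret a, g => g a
  | query i z k, g => (k (F i z)).mean F g
  | draw _ p k, g => ∑ j, (p j).toReal * (k j).mean F g

/-- `Q a m` holds whenever some sequence of draws leads to the result `a` after `m` queries. -/
def Post (F : Fin n → E → E) : Prog n E α → (α → ℕ → Prop) → Prop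
  | ret a, Q => Q a 0
  | query i z k, Q => (k (F i z)).Post F (fun a m => Q a (m + 1))
  | draw _ _ k, Q => ∀ j, (k j).Post F Q

/-- The program makes no draws and returns `a` after `c` queries. -/
def Returns (F : Fin n → E → E) : Prog n E α → α → ℕ → Prop
  | ret b, a, c => b = a ∧ c = 0
  | query i z k, a, c => ∃ c', (k (F i z)).Returns F a c' ∧ c = c' + 1
  | draw _ _ _, _, _ => False

variable {F : Fin n → E → E}

theorem monad_bind_eq (p : Prog n E α) (f : α → Prog n E β) : (p >>= f) = p.bind f := rfl

theorem monad_pure_eq (a : α) : (pure a : Prog n E α) = ret a := rfl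

theorem mean_bind (p : Prog n E α) (f : α → Prog n E β) (g : β → ℝ) :
    (p.bind f).mean F g = p.mean F (fun a => (f a).mean F g) := by
  induction p with
  | ret a => rfl
  | query i z k ih => exact ih _
  | draw m p k ih => simp only [bind, mean, ih]

theorem Post.bind {p : Prog n E α} {f : α → Prog n E β} {Q : β → ℕ → Prop}
    (h : p.Post F (fun a m => (f a).Post F (fun b m' => Q b (m + m')))) :
    (p.bind f).Post F Q := by
  induction p generalizing Q with
  | ret a => simpa [Prog.bind, Post] using h
  | query i z k ih =>
    refine ih _ ?_
    simpa only [Post, Nat.add_right_comm] using h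
  | draw m p k ih => exact fun j => ih j (h j)

theorem Post.mono {p : Prog n E α} {Q R : α → ℕ → Prop} (h : p.Post F Q)
    (hQR : ∀ a m, Q a m → R a m) : p.Post F R := by
  induction p generalizing Q R with
  | ret a => exact hQR _ _ h
  | query i z k ih => exact ih _ h (fun a m => hQR a (m + 1))
  | draw m p k ih => exact fun j => ih j (h j) hQR

theorem Post.of_mem_support {p : Prog n E α} {Q : α → ℕ → Prop} (h : p.Post F Q) :
    ∀ o ∈ (p.run F).support, Q o.1 o.2 := by
  induction p generalizing Q with
  | ret a =>
    intro o ho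
    rw [run, PMF.mem_support_pure_iff] at ho
    subst ho
    exact h
  | query i z k ih =>
    intro o ho
    rw [run, PMF.mem_support_map_iff] at ho
    obtain ⟨o', ho', rfl⟩ := ho
    exact ih _ h o' ho'
  | draw m p k ih =>
    intro o ho
    rw [run, PMF.mem_support_bind_iff] at ho
    obtain ⟨j, -, hj⟩ := ho
    exact ih j (h j) o hj

theorem _root_.PMF.sum_toReal_eq_one {m : ℕ} (p : PMF (Fin m)) : ∑ j, (p j).toReal = 1 := by
  rw [← ENNReal.toReal_sum (fun j _ => p.apply_ne_top j), ← tsum_fintype (L := .unconditional _),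
    p.tsum_coe, ENNReal.toReal_one]

/-- The comparison is needed only at results that can be reached. This is how feasibility of the
iterates, a `Post` fact, enters the estimates of expectations. -/
theorem mean_mono {p : Prog n E α} {Q : α → ℕ → Prop} {g g' : α → ℝ} (h : p.Post F Q)
    (hg : ∀ a m, Q a m → g a ≤ g' a) : p.mean F g ≤ p.mean F g' := by
  induction p generalizing Q with
  | ret a => exact hg _ _ h
  | query i z k ih => exact ih _ h (fun a m => hg a (m + 1))
  | draw m p k ih =>
    exact Finset.sum_le_sum fun j _ =>
      mul_le_mul_of_nonneg_left (ih j (h j) hg) ENNReal.toReal_nonneg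

theorem mean_affine (p : Prog n E α) (c d : ℝ) (g : α → ℝ) :
    p.mean F (fun a => c * g a + d) = c * p.mean F g + d := by
  induction p with
  | ret a => rfl
  | query i z k ih => exact ih _
  | draw m p k ih =>
    simp only [mean, ih]
    rw [Finset.mul_sum]
    simp only [mul_add, Finset.sum_add_distrib, ← Finset.sum_mul, PMF.sum_toReal_eq_one, one_mul]
    congr 1
    exact Finset.sum_congr rfl fun j _ => by ring

theorem mean_const_mul (p : Prog n E α) (c : ℝ) (g : α → ℝ) :
    p.mean F (fun a => c * g a) = c * p.mean F g := by
  simpa using p.mean_affine (F := F) c 0 g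

theorem mean_nonneg (p : Prog n E α) {g : α → ℝ} (hg : ∀ a, 0 ≤ g a) : 0 ≤ p.mean F g := by
  induction p with
  | ret a => exact hg a
  | query i z k ih => exact ih _
  | draw m p k ih =>
    exact Finset.sum_nonneg fun j _ => mul_nonneg ENNReal.toReal_nonneg (ih j)

theorem _root_.IPP.expect_pure {Ω : Type} (a : Ω) (g : Ω → ℝ≥0∞) :
    expect (PMF.pure a) g = g a := by
  classical
  rw [expect, tsum_eq_single a]
  · simp
  · intro b hb
    simp [PMF.pure_apply, hb]

theorem _root_.IPP.expect_bind {Ω Ω' : Type} (P : PMF Ω) (f : Ω → PMF Ω') (g : Ω' → ℝ≥0∞) :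
    expect (P.bind f) g = expect P (fun a => expect (f a) g) := by
  simp only [expect, PMF.bind_apply, ← ENNReal.tsum_mul_right, ← ENNReal.tsum_mul_left]
  rw [ENNReal.tsum_comm]
  simp only [mul_assoc]

theorem _root_.IPP.expect_map {Ω Ω' : Type} (P : PMF Ω) (f : Ω → Ω') (g : Ω' → ℝ≥0∞) :
    expect (P.map f) g = expect P (fun a => g (f a)) := by
  rw [PMF.map, expect_bind]
  simp only [Function.comp, expect_pure]

/-- Every draw is from a finite set, so `mean` is built from finite sums and the estimates can be
made in ℝ. This is the bridge back to the law `run`. -/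
theorem expect_run (p : Prog n E α) {g : α → ℝ} (hg : ∀ a, 0 ≤ g a) :
    expect (p.run F) (fun o => ENNReal.ofReal (g o.1)) = ENNReal.ofReal (p.mean F g) := by
  induction p with
  | ret a => exact expect_pure _ _
  | query i z k ih =>
    rw [run, expect_map]
    exact ih _
  | draw m p k ih =>
    rw [run, expect_bind]
    simp only [ih, mean]
    rw [expect, tsum_fintype, ENNReal.ofReal_sum_of_nonneg]
    · refine Finset.sum_congr rfl fun j _ => ?_
      rw [ENNReal.ofReal_mul ENNReal.toReal_nonneg, ENNReal.ofReal_toReal (p.apply_ne_top j)]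
    · exact fun j _ => mul_nonneg ENNReal.toReal_nonneg (mean_nonneg _ hg)

theorem Returns.mean_bind {p : Prog n E α} {a : α} {c : ℕ} (h : p.Returns F a c)
    (f : α → Prog n E β) (g : β → ℝ) : (p.bind f).mean F g = (f a).mean F g := by
  induction p generalizing c with
  | ret b => rw [← h.1]; rfl
  | query i z k ih =>
    obtain ⟨c', hc', -⟩ := h
    exact ih _ hc'
  | draw m p k ih => exact h.elim

theorem Returns.post {p : Prog n E α} {a : α} {c : ℕ} (h : p.Returns F a c)
    {Q : α → ℕ → Prop} (hQ : Q a c) : p.Post F Q := by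
  induction p generalizing c Q with
  | ret b =>
    obtain ⟨rfl, rfl⟩ := h
    exact hQ
  | query i z k ih =>
    obtain ⟨c', hc', rfl⟩ := h
    exact ih _ hc' hQ
  | draw m p k ih => exact h.elim

theorem Returns.bind {p : Prog n E α} {a : α} {c : ℕ} (h : p.Returns F a c)
    {f : α → Prog n E β} {b : β} {c' : ℕ} (h' : (f a).Returns F b c') :
    (p.bind f).Returns F b (c + c') := by
  induction p generalizing c with
  | ret b =>
    obtain ⟨rfl, rfl⟩ := h
    rw [Nat.zero_add]; exact h'
  | query i z k ih =>
    obtain ⟨c₁, hc₁, rfl⟩ := h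
    exact ⟨c₁ + c', ih _ hc₁, by omega⟩
  | draw m p k ih => exact h.elim

theorem Returns.post_bind {p : Prog n E α} {a : α} {c : ℕ} (h : p.Returns F a c)
    {f : α → Prog n E β} {Q : β → ℕ → Prop} (hQ : (f a).Post F (fun b m => Q b (c + m))) :
    (p.bind f).Post F Q :=
  Post.bind (h.post hQ)

theorem returns_ret (a : α) : (ret a : Prog n E α).Returns F a 0 := ⟨rfl, rfl⟩

end Prog

end

/-! ### Projections, resolvents and strongly monotone variational inequalities -/

section


variable {E : Type} [NormedAddCommGroup E] [InnerProductSpace ℝ E] {Z : Set E}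

theorem exists_proj_inner_le [CompleteSpace E] (hne : Z.Nonempty) (hcl : IsClosed Z)
    (hcv : Convex ℝ Z) (z : E) : ∃ p ∈ Z, ∀ y ∈ Z, inner ℝ (z - p) (y - p) ≤ 0 := by
  obtain ⟨p, hp, h⟩ := exists_norm_eq_iInf_of_complete_convex hne hcl.isComplete hcv z
  exact ⟨p, hp, (norm_eq_iInf_iff_real_inner_le_zero hcv hp).1 h⟩

theorem norm_sub_le_of_inner_le {z p y : E} (h : inner ℝ (z - p) (y - p) ≤ 0) :
    ‖z - p‖ ≤ ‖z - y‖ := by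
  have h1 : ‖z - y‖ ^ 2 = ‖z - p‖ ^ 2 - 2 * inner ℝ (z - p) (y - p) + ‖y - p‖ ^ 2 := by
    rw [← norm_sub_sq_real]; congr 2; abel
  exact (sq_le_sq₀ (norm_nonneg _) (norm_nonneg _)).1 (by nlinarith [sq_nonneg ‖y - p‖])

/-- `proj` is merely some chosen distance minimizer; the obtuse angle condition is recovered from
minimality. -/
theorem proj_spec [CompleteSpace E] (hne : Z.Nonempty) (hcl : IsClosed Z)
    (hcv : Convex ℝ Z) (z : E) :
    proj Z z ∈ Z ∧ ∀ y ∈ Z, inner ℝ (z - proj Z z) (y - proj Z z) ≤ 0 := by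
  obtain ⟨p, hp, hp'⟩ := exists_proj_inner_le hne hcl hcv z
  have hq := Classical.epsilon_spec (p := fun p => p ∈ Z ∧ ∀ y ∈ Z, ‖z - p‖ ≤ ‖z - y‖)
    ⟨p, hp, fun y hy => norm_sub_le_of_inner_le (hp' y hy)⟩
  change proj Z z ∈ Z ∧ ∀ y ∈ Z, ‖z - proj Z z‖ ≤ ‖z - y‖ at hq
  refine ⟨hq.1, (norm_eq_iInf_iff_real_inner_le_zero hcv hq.1).1 ?_⟩
  have : Nonempty Z := hne.to_subtype
  refine le_antisymm (le_ciInf fun y => hq.2 y y.2) ?_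
  exact ciInf_le ⟨0, by rintro _ ⟨y, rfl⟩; exact norm_nonneg _⟩ (⟨proj Z z, hq.1⟩ : Z)

/-- Points characterized by the obtuse angle condition depend nonexpansively on the data. -/
theorem norm_sub_le_of_obtuse {a b p q : E} (hp : inner ℝ (a - p) (q - p) ≤ 0)
    (hq : inner ℝ (b - q) (p - q) ≤ 0) : ‖p - q‖ ≤ ‖a - b‖ := by
  have h1 : ‖p - q‖ ^ 2 ≤ inner ℝ (a - b) (p - q) := by
    have h2 : inner ℝ (a - b) (p - q) =
        ‖p - q‖ ^ 2 - inner ℝ (a - p) (q - p) - inner ℝ (b - q) (p - q) := by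
      rw [← real_inner_self_eq_norm_sq, ← neg_sub p q, inner_neg_right, sub_neg_eq_add,
        ← inner_add_left, ← inner_sub_left]
      congr 1; abel
    linarith
  have h3 := real_inner_le_norm (a - b) (p - q)
  rcases (norm_nonneg (p - q)).eq_or_lt with h0 | h0
  · rw [← h0]; positivity
  · nlinarith

theorem resolvent_spec [CompleteSpace E] (hne : Z.Nonempty) (hcl : IsClosed Z)
    (hcv : Convex ℝ Z) {η μ : ℝ} (hη : 0 < η) (hμ : 0 < μ) (w z : E) :
    ∃ v ∈ normalCone Z (resolvent η (opA μ w Z) z),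
      resolvent η (opA μ w Z) z + η • (μ • (resolvent η (opA μ w Z) z - w) + v) = z := by
  have key : ∃ p, ∃ a ∈ opA μ w Z p, p + η • a = z := by
    have hc : 0 < 1 + η * μ := by positivity
    -- Completing the square: p + ημ(p - w) + ηv = z with v normal at p says that p is the
    -- projection of (z + ημw)/(1 + ημ).
    obtain ⟨p, hp, hp'⟩ := exists_proj_inner_le hne hcl hcv ((1 + η * μ)⁻¹ • (z + (η * μ) • w))
    refine ⟨p, _, ⟨η⁻¹ • (z - p) - μ • (p - w), ⟨hp, fun y hy => ?_⟩, rfl⟩, ?_⟩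
    · have h1 := hp' y hy
      have h2 : η⁻¹ • (z - p) - μ • (p - w) =
          (η⁻¹ * (1 + η * μ)) • ((1 + η * μ)⁻¹ • (z + (η * μ) • w) - p) := by
        (match_scalars <;> field_simp); ring
      rw [h2, real_inner_smul_left]
      exact mul_nonpos_of_nonneg_of_nonpos (by positivity) h1
    · match_scalars <;> field_simp <;> ring
  have hs := Classical.epsilon_spec key
  change ∃ a ∈ opA μ w Z (resolvent η (opA μ w Z) z), resolvent η (opA μ w Z) z + η • a = z at hs
  obtain ⟨a, ⟨v, hv, rfl⟩, h⟩ := hs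
  exact ⟨v, hv, h⟩

theorem resolvent_mem [CompleteSpace E] (hne : Z.Nonempty) (hcl : IsClosed Z)
    (hcv : Convex ℝ Z) {η μ : ℝ} (hη : 0 < η) (hμ : 0 < μ) (w z : E) :
    resolvent η (opA μ w Z) z ∈ Z := by
  obtain ⟨v, hv, -⟩ := resolvent_spec hne hcl hcv hη hμ w z
  exact hv.1

/-- The resolvent of the `μ`-strongly monotone operator `opA μ w Z` is a contraction. -/
theorem norm_resolvent_sub_le [CompleteSpace E] (hcl : IsClosed Z)
    (hcv : Convex ℝ Z) {η μ : ℝ} (hη : 0 < η) (hμ : 0 < μ) (w z zb v : E)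
    (hv : v ∈ normalCone Z zb) :
    (1 + η * μ) * ‖resolvent η (opA μ w Z) z - zb‖ ≤ ‖z - (zb + η • (μ • (zb - w) + v))‖ := by
  obtain ⟨u, hu, h⟩ := resolvent_spec ⟨zb, hv.1⟩ hcl hcv hη hμ w z
  set p := resolvent η (opA μ w Z) z
  have h1 := hu.2 zb hv.1
  have h2 := hv.2 p hu.1
  have h3 : inner ℝ (z - (zb + η • (μ • (zb - w) + v))) (p - zb) =
      (1 + η * μ) * ‖p - zb‖ ^ 2 - η * inner ℝ u (zb - p) - η * inner ℝ v (p - zb) := by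
    rw [← real_inner_self_eq_norm_sq, ← neg_sub p zb, inner_neg_right, ← real_inner_smul_left,
      ← real_inner_smul_left, mul_neg, ← real_inner_smul_left, sub_neg_eq_add, ← inner_add_left,
      ← inner_sub_left, ← h]
    congr 1
    module
  have h4 := real_inner_le_norm (z - (zb + η • (μ • (zb - w) + v))) (p - zb)
  rcases (norm_nonneg (p - zb)).eq_or_lt with h0 | h0
  · rw [← h0]; simp
  · have h5 : 0 ≤ -(η * inner ℝ u (zb - p)) := by
      rw [← mul_neg]; exact mul_nonneg hη.le (by linarith)
    have h6 : 0 ≤ -(η * inner ℝ v (p - zb)) := by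
      rw [← mul_neg]; exact mul_nonneg hη.le (by linarith)
    refine le_of_mul_le_mul_right ?_ h0
    nlinarith

theorem IsSVISolution.neg_mem_normalCone {G : E → E} {zb : E} (h : IsSVISolution G Z zb) :
    -G zb ∈ normalCone Z zb :=
  ⟨h.1, fun y hy => by rw [inner_neg_left]; linarith [h.2 y hy]⟩

/-- `μ`-strong monotonicity on `Z`. -/
def StronglyMonotoneOn (μ : ℝ) (G : E → E) (Z : Set E) : Prop :=
  ∀ z ∈ Z, ∀ z' ∈ Z, μ * ‖z - z'‖ ^ 2 ≤ inner ℝ (G z - G z') (z - z')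

/-- A projected step with the map `G` does not expand distances to the solution by more than
`1 + c Λ`. -/
theorem norm_proj_step_sub_le [CompleteSpace E] (hcl : IsClosed Z)
    (hcv : Convex ℝ Z) {G : E → E} {Λ c : ℝ} (hc : 0 ≤ c) {zb w : E} (hzb : IsSVISolution G Z zb)
    (hlip : ‖G w - G zb‖ ≤ Λ * ‖w - zb‖) :
    ‖proj Z (w - c • G w) - zb‖ ≤ (1 + c * Λ) * ‖w - zb‖ := by
  have hp := proj_spec ⟨zb, hzb.1⟩ hcl hcv (w - c • G w)
  have h1 : ‖proj Z (w - c • G w) - zb‖ ≤ ‖(w - c • G w) - (zb - c • G zb)‖ := by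
    -- The solution satisfies the angle condition for `zb - c • G zb`, so it is a fixed point of the
    -- projected step.
    refine norm_sub_le_of_obtuse (hp.2 zb hzb.1) ?_
    have h2 : zb - c • G zb - zb = -(c • G zb) := by abel
    rw [h2, inner_neg_left, real_inner_smul_left]
    have := mul_nonneg hc (hzb.2 _ hp.1)
    linarith
  refine h1.trans ?_
  have h3 : (w - c • G w) - (zb - c • G zb) = (w - zb) - c • (G w - G zb) := by module
  rw [h3]
  refine (norm_sub_le _ _).trans ?_
  rw [norm_smul, Real.norm_of_nonneg hc]
  nlinarith [mul_le_mul_of_nonneg_left hlip hc]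

theorem StronglyMonotoneOn.svi_unique {μ : ℝ} (hμ : 0 < μ) {G : E → E}
    (hG : StronglyMonotoneOn μ G Z) {z z' : E} (hz : IsSVISolution G Z z)
    (hz' : IsSVISolution G Z z') : z = z' := by
  have h1 := hz.2 z' hz'.1
  have h2 := hz'.2 z hz.1
  have h3 := hG z hz.1 z' hz'.1
  rw [inner_sub_left] at h3
  rw [← neg_sub z z', inner_neg_right] at h1
  have h4 : ‖z - z'‖ ^ 2 ≤ 0 := by nlinarith [sq_nonneg ‖z - z'‖]
  have h5 : ‖z - z'‖ = 0 := by nlinarith [norm_nonneg (z - z')]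
  exact sub_eq_zero.1 (norm_eq_zero.1 h5)

/-- Expansion of the square. It serves twice: for the contraction behind existence, and with μ = 0
for the forward step of SVRG, whose operator is only monotone. -/
theorem norm_sub_smul_sq_le {x y : E} {μ l η : ℝ} (hη : 0 ≤ η)
    (hmono : μ * ‖x‖ ^ 2 ≤ inner ℝ y x) (hlip : ‖y‖ ≤ l * ‖x‖) :
    ‖x - η • y‖ ^ 2 ≤ (1 - 2 * η * μ + η ^ 2 * l ^ 2) * ‖x‖ ^ 2 := by
  have h1 : ‖x - η • y‖ ^ 2 = ‖x‖ ^ 2 - 2 * η * inner ℝ y x + η ^ 2 * ‖y‖ ^ 2 := by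
    rw [norm_sub_sq_real, real_inner_smul_right, norm_smul, mul_pow, Real.norm_eq_abs, sq_abs,
      real_inner_comm]
    ring
  have h2 : ‖y‖ ^ 2 ≤ l ^ 2 * ‖x‖ ^ 2 := by
    rw [← mul_pow]; exact pow_le_pow_left₀ (norm_nonneg _) hlip 2
  rw [h1]
  nlinarith [mul_le_mul_of_nonneg_left hmono hη, mul_le_mul_of_nonneg_left h2 (sq_nonneg η)]

theorem StronglyMonotoneOn.exists_svi [CompleteSpace E] (hne : Z.Nonempty) (hcl : IsClosed Z)
    (hcv : Convex ℝ Z) {μ Λ : ℝ} (hμ : 0 < μ) (hΛ : 0 < Λ) {G : E → E}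
    (hG : StronglyMonotoneOn μ G Z)
    (hlip : ∀ z ∈ Z, ∀ z' ∈ Z, ‖G z - G z'‖ ≤ Λ * ‖z - z'‖) : ∃ z, IsSVISolution G Z z := by
  -- This choice minimizes 1 - 2cμ + c²Λ², the squared contraction factor of the projected step.
  set c : ℝ := μ / Λ ^ 2 with hc
  have hc0 : 0 < c := by positivity
  have hP := proj_spec hne hcl hcv
  have : CompleteSpace Z := hcl.completeSpace_coe
  have : Nonempty Z := hne.to_subtype
  let φ : Z → Z := fun z => ⟨proj Z (z - c • G z), (hP _).1⟩
  set r : ℝ := √(1 - μ ^ 2 / Λ ^ 2) with hr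
  have hr1 : r < 1 := by
    rw [hr, Real.sqrt_lt' one_pos]
    have : 0 < μ ^ 2 / Λ ^ 2 := by positivity
    linarith
  have hr0 : 0 ≤ r := Real.sqrt_nonneg _
  have hφ : ContractingWith ⟨r, hr0⟩ φ := by
    refine ⟨by exact_mod_cast hr1, LipschitzWith.of_dist_le_mul fun a b => ?_⟩
    change dist (proj Z (a - c • G a)) (proj Z (b - c • G b)) ≤ r * dist (a : E) b
    rw [dist_eq_norm, dist_eq_norm]
    have h1 := norm_sub_le_of_obtuse ((hP (a - c • G a)).2 _ (hP (b - c • G b)).1)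
      ((hP (b - c • G b)).2 _ (hP (a - c • G a)).1)
    refine h1.trans ?_
    have h2 : (a : E) - c • G a - (b - c • G b) = ((a : E) - b) - c • (G a - G b) := by module
    have h3 := norm_sub_smul_sq_le hc0.le (hG a a.2 b b.2) (hlip a a.2 b b.2)
    have h4 : 1 - 2 * c * μ + c ^ 2 * Λ ^ 2 = 1 - μ ^ 2 / Λ ^ 2 := by
      rw [hc]; field_simp; ring
    rw [h4] at h3
    rw [h2, ← Real.sqrt_sq (norm_nonneg ((a : E) - b)), hr, ← Real.sqrt_mul' _ (sq_nonneg _)]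
    exact Real.le_sqrt_of_sq_le h3
  obtain ⟨x, hx⟩ : ∃ x : Z, φ x = x := ⟨_, hφ.fixedPoint_isFixedPt⟩
  have hfix : proj Z ((x : E) - c • G x) = x := congrArg Subtype.val hx
  refine ⟨x, x.2, fun y hy => ?_⟩
  have h := (hP ((x : E) - c • G x)).2 y hy
  rw [hfix, sub_sub_cancel_left, inner_neg_left, real_inner_smul_left] at h
  by_contra! hlt
  nlinarith [mul_neg_of_pos_of_neg hc0 hlt]

end

/-! ### Convergence and cost of SVRG -/

section


variable {E : Type} [NormedAddCommGroup E] [InnerProductSpace ℝ E] {Z : Set E} {n : ℕ}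
  {F H : Fin n → E → E} {G : Fin n → E → Prog n E E}

open Prog

theorem returns_proxComponent (γ : ℝ) (w : E) (i : Fin n) (z : E) :
    (proxComponent γ w i z).Returns F (proxMap (F i) γ w z) 1 :=
  ⟨0, ⟨rfl, rfl⟩, rfl⟩

theorem returns_sumComponents (hG : ∀ i z, (G i z).Returns F (H i z) 1) (z : E)
    (l : List (Fin n)) :
    (sumComponents G z l).Returns F (l.map (fun i => H i z)).sum l.length := by
  induction l with
  | nil => exact returns_ret _
  | cons i l ih =>
    have h := (hG i z).bind (ih.bind (returns_ret (F := F) (n := n)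
      (H i z + (l.map (fun i => H i z)).sum)) (f := fun s => ret (H i z + s)))
      (f := fun g => (sumComponents G z l).bind fun s => ret (g + s))
    rw [add_zero, Nat.add_comm] at h
    rw [List.map_cons, List.sum_cons, List.length_cons]
    exact h

theorem returns_fullMap (hG : ∀ i z, (G i z).Returns F (H i z) 1) (z : E) :
    (fullMap G z).Returns F (avg H z) n := by
  have h := (returns_sumComponents hG z (List.finRange n)).bind
    (returns_ret (F := F) (n := n) ((n : ℝ)⁻¹ • ((List.finRange n).map (fun i => H i z)).sum))
    (f := fun s => ret ((n : ℝ)⁻¹ • s))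
  rw [List.length_finRange, add_zero, ← List.ofFn_eq_map, List.sum_ofFn] at h
  exact h

/-- The stochastic estimate of `avg H z - μ (z - w)` in the inner loop of SVRG. -/
def varianceReduced (H : Fin n → E → E) (μ : ℝ) (w wt z : E) (i : Fin n) : E :=
  avg H wt - μ • (z - w) + (H i z - H i wt)

/-- The factors n cancel in n • B_i, and the terms in `wt - w` drop out of the estimate. -/
theorem svrgInner_succ_eq [NeZero n] (G : Fin n → E → Prog n E E) (μ η : ℝ) (w wt : E) (s : ℕ)
    (a z : E) :
    svrgInner G Z μ η w wt (a - μ • (wt - w)) (s + 1) z =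
      draw n (PMF.uniformOfFintype (Fin n)) fun i => (G i wt).bind fun gw => (G i z).bind fun gz =>
        svrgInner G Z μ η w wt (a - μ • (wt - w)) s
          (resolvent η (opA μ w Z) (z - η • (a - μ • (z - w) + (gz - gw)))) := by
  have hn : (n : ℝ) ≠ 0 := Nat.cast_ne_zero.2 (NeZero.ne n)
  have hB : ∀ gw gz : E, a - μ • (wt - w) - (n : ℝ) • compB n μ w wt gw +
      (n : ℝ) • compB n μ w z gz = a - μ • (z - w) + (gz - gw) := by
    intro gw gz
    simp only [compB, smul_sub, smul_smul, mul_inv_cancel₀ hn, mul_div_cancel₀ _ hn, one_smul]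
    abel
  simp only [← hB]
  rfl

theorem post_svrgInner [CompleteSpace E] [NeZero n] (hG : ∀ i z, (G i z).Returns F (H i z) 1)
    (hcl : IsClosed Z) (hcv : Convex ℝ Z) {μ η : ℝ} (hμ : 0 < μ) (hη : 0 < η) (w wt a : E)
    (s : ℕ) (z : E) (hz : z ∈ Z) :
    (svrgInner G Z μ η w wt (a - μ • (wt - w)) s z).Post F (fun r m => r ∈ Z ∧ m = 2 * s) := by
  induction s generalizing z with
  | zero => exact ⟨hz, rfl⟩
  | succ s ih =>
    rw [svrgInner_succ_eq]
    refine fun i => (hG i wt).post_bind ((hG i z).post_bind ?_)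
    refine (ih _ (resolvent_mem ⟨z, hz⟩ hcl hcv hη hμ _ _)).mono fun r m h => ⟨h.1, ?_⟩
    rw [h.2]; ring

theorem mean_svrgInner_succ [NeZero n] (hG : ∀ i z, (G i z).Returns F (H i z) 1) (μ η : ℝ)
    (w wt : E) (s : ℕ) (z : E) (g : E → ℝ) :
    (svrgInner G Z μ η w wt (avg H wt - μ • (wt - w)) (s + 1) z).mean F g =
      (n : ℝ)⁻¹ * ∑ i, (svrgInner G Z μ η w wt (avg H wt - μ • (wt - w)) s
        (resolvent η (opA μ w Z) (z - η • varianceReduced H μ w wt z i))).mean F g := by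
  rw [svrgInner_succ_eq, mean, Finset.mul_sum]
  refine Finset.sum_congr rfl fun i _ => ?_
  rw [(hG i wt).mean_bind, (hG i z).mean_bind, PMF.uniformOfFintype_apply, Fintype.card_fin,
    ENNReal.toReal_inv, ENNReal.toReal_natCast]
  rfl

/-- The second moment is at least the variance. -/
theorem mean_norm_sub_mean_sq_le [NeZero n] (u : E) (η : ℝ) (V : Fin n → E) :
    (n : ℝ)⁻¹ * ∑ i, ‖u - η • (V i - (n : ℝ)⁻¹ • ∑ j, V j)‖ ^ 2 ≤
      ‖u‖ ^ 2 + η ^ 2 * ((n : ℝ)⁻¹ * ∑ i, ‖V i‖ ^ 2) := by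
  have hn : (n : ℝ) ≠ 0 := Nat.cast_ne_zero.2 (NeZero.ne n)
  set m : E := (n : ℝ)⁻¹ • ∑ j, V j with hm
  have hs : ∑ j, V j = (n : ℝ) • m := by rw [hm, smul_smul, mul_inv_cancel₀ hn, one_smul]
  have h1 : ∀ i, ‖u - η • (V i - m)‖ ^ 2 = ‖u + η • m‖ ^ 2 - 2 * η * inner ℝ (u + η • m) (V i)
      + η ^ 2 * ‖V i‖ ^ 2 := by
    intro i
    have : u - η • (V i - m) = (u + η • m) - η • V i := by module
    rw [this, norm_sub_sq_real, real_inner_smul_right, norm_smul, mul_pow, Real.norm_eq_abs, sq_abs]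
    ring
  have h2 : ‖u + η • m‖ ^ 2 = ‖u‖ ^ 2 + 2 * η * inner ℝ u m + η ^ 2 * ‖m‖ ^ 2 := by
    rw [norm_add_sq_real, real_inner_smul_right, norm_smul, mul_pow, Real.norm_eq_abs, sq_abs]
    ring
  simp only [h1, Finset.sum_add_distrib, Finset.sum_sub_distrib, ← Finset.mul_sum, ← inner_sum, hs,
    Finset.sum_const, Finset.card_univ, Fintype.card_fin, nsmul_eq_mul, real_inner_smul_right]
  rw [inner_add_left, real_inner_smul_left, real_inner_self_eq_norm_sq, h2]
  have h3 : (n : ℝ)⁻¹ * (n * (‖u‖ ^ 2 + 2 * η * inner ℝ u m + η ^ 2 * ‖m‖ ^ 2) -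
      2 * η * (n * (inner ℝ u m + η * ‖m‖ ^ 2)) + η ^ 2 * ∑ i, ‖V i‖ ^ 2) =
      ‖u‖ ^ 2 - η ^ 2 * ‖m‖ ^ 2 + η ^ 2 * ((n : ℝ)⁻¹ * ∑ i, ‖V i‖ ^ 2) := by
    field_simp; ring
  rw [h3]
  nlinarith [mul_nonneg (sq_nonneg η) (sq_nonneg ‖m‖)]

theorem inv_mul_sum_le [NeZero n] {f : Fin n → ℝ} {c : ℝ} (h : ∀ i, f i ≤ c) :
    (n : ℝ)⁻¹ * ∑ i, f i ≤ c := by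
  have hn : (0 : ℝ) < n := Nat.cast_pos.2 (NeZero.pos n)
  rw [inv_mul_le_iff₀ hn]
  simpa using Finset.sum_le_card_nsmul Finset.univ f c (fun i _ => h i)

theorem norm_avg_sub_le [NeZero n] {Λ : ℝ}
    (hlip : ∀ i, ∀ z ∈ Z, ∀ z' ∈ Z, ‖H i z - H i z'‖ ≤ Λ * ‖z - z'‖) :
    ∀ z ∈ Z, ∀ z' ∈ Z, ‖avg H z - avg H z'‖ ≤ Λ * ‖z - z'‖ := by
  intro z hz z' hz'
  rw [avg, avg, ← smul_sub, ← Finset.sum_sub_distrib, norm_smul, Real.norm_of_nonneg (by positivity)]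
  refine (mul_le_mul_of_nonneg_left (norm_sum_le _ _) (by positivity)).trans ?_
  exact inv_mul_sum_le fun i => hlip i z hz z' hz'

/-- One inner step of SVRG contracts the mean squared distance to the solution, up to the squared
distance of the snapshot. -/
theorem svrg_step [CompleteSpace E] [NeZero n] (hcl : IsClosed Z) (hcv : Convex ℝ Z) {μ Λ : ℝ}
    (hμ : 0 < μ) (hΛ : 0 < Λ) (hmono : StronglyMonotoneOn μ (avg H) Z)
    (hlip : ∀ i, ∀ z ∈ Z, ∀ z' ∈ Z, ‖H i z - H i z'‖ ≤ Λ * ‖z - z'‖) {zb : E}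
    (hzb : IsSVISolution (avg H) Z zb) (w wt z : E) (hwt : wt ∈ Z) (hz : z ∈ Z) {η : ℝ}
    (hη : η = μ / (4 * (Λ + μ) ^ 2)) :
    (1 + η * μ) ^ 2 * ((n : ℝ)⁻¹ * ∑ i,
        ‖resolvent η (opA μ w Z) (z - η • varianceReduced H μ w wt z i) - zb‖ ^ 2) ≤
      (1 + 3 / 4 * (η * μ)) * ‖z - zb‖ ^ 2 + η * μ / 2 * ‖wt - zb‖ ^ 2 := by
  have hl : 0 < Λ + μ := by positivity
  have hη0 : 0 < η := by rw [hη]; positivity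
  have hη2 : η ^ 2 * (Λ + μ) ^ 2 = η * μ / 4 := by rw [hη]; field_simp
  set V : Fin n → E := fun i => H i z - H i wt - μ • (z - wt) with hV
  have hVn : ∀ i, ‖V i‖ ^ 2 ≤ (Λ + μ) ^ 2 * ‖z - wt‖ ^ 2 := by
    intro i
    rw [← mul_pow]
    refine pow_le_pow_left₀ (norm_nonneg _) ?_ 2
    refine (norm_sub_le _ _).trans ?_
    rw [norm_smul, Real.norm_of_nonneg hμ.le]
    linarith [hlip i z hz wt hwt]
  have hn : (n : ℝ) ≠ 0 := Nat.cast_ne_zero.2 (NeZero.ne n)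
  have hVm : (n : ℝ)⁻¹ • ∑ i, V i = avg H z - avg H wt - μ • (z - wt) := by
    simp only [hV, Finset.sum_sub_distrib, Finset.sum_const, Finset.card_univ, Fintype.card_fin,
      smul_sub, avg, ← Nat.cast_smul_eq_nsmul ℝ, smul_smul]
    simp only [inv_mul_cancel_left₀ hn]
  set y : E := avg H z - avg H zb - μ • (z - zb) with hy
  -- Since -G(zb) is normal at zb, the point zb is the resolvent of zb - ηB(zb), where B(z) = G(z) -
  -- μ(z - w). The difference of the two arguments splits into a mean part and a centred noise part.
  have hstep : ∀ i, (1 + η * μ) ^ 2 *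
      ‖resolvent η (opA μ w Z) (z - η • varianceReduced H μ w wt z i) - zb‖ ^ 2 ≤
      ‖(z - zb - η • y) - η • (V i - (n : ℝ)⁻¹ • ∑ j, V j)‖ ^ 2 := by
    intro i
    rw [← mul_pow]
    refine pow_le_pow_left₀ (by positivity) ?_ 2
    refine (norm_resolvent_sub_le hcl hcv hη0 hμ w _ zb _ hzb.neg_mem_normalCone).trans_eq ?_
    rw [hVm]
    congr 1
    simp only [varianceReduced, hV, hy]
    module
  -- All the strong monotonicity has been moved into the resolvent; plain monotonicity remains.
  have hmono' : 0 * ‖z - zb‖ ^ 2 ≤ inner ℝ y (z - zb) := by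
    rw [hy, inner_sub_left, real_inner_smul_left, real_inner_self_eq_norm_sq]
    linarith [hmono z hz zb hzb.1]
  have hylip : ‖y‖ ≤ (Λ + μ) * ‖z - zb‖ := by
    refine (norm_sub_le _ _).trans ?_
    rw [norm_smul, Real.norm_of_nonneg hμ.le]
    linarith [norm_avg_sub_le hlip z hz zb hzb.1]
  have hu := norm_sub_smul_sq_le hη0.le hmono' hylip
  have hzw : ‖z - wt‖ ^ 2 ≤ 2 * ‖z - zb‖ ^ 2 + 2 * ‖wt - zb‖ ^ 2 := by
    have h1 := norm_sub_le (z - zb) (wt - zb)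
    rw [sub_sub_sub_cancel_right] at h1
    nlinarith [norm_nonneg (z - wt), sq_nonneg (‖z - zb‖ - ‖wt - zb‖)]
  have hvar := mean_norm_sub_mean_sq_le (z - zb - η • y) η V
  have hVavg := mul_le_mul_of_nonneg_left (inv_mul_sum_le hVn) (sq_nonneg η)
  have hsum := mul_le_mul_of_nonneg_left (Finset.sum_le_sum fun i (_ : i ∈ Finset.univ) => hstep i)
    (inv_nonneg.2 (Nat.cast_nonneg (α := ℝ) n))
  rw [← Finset.mul_sum, mul_left_comm] at hsum
  rw [← mul_assoc (η ^ 2) ((Λ + μ) ^ 2), hη2] at hVavg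
  rw [hη2] at hu
  have hημ : 0 ≤ η * μ := by positivity
  nlinarith [mul_le_mul_of_nonneg_left hzw hημ]

/-- One step is dominated by an affine map of the squared distance with fixed point W/2, where W is
the squared distance of the snapshot. The excess over W/2 decays geometrically. -/
theorem mean_svrgInner_le [CompleteSpace E] [NeZero n] (hG : ∀ i z, (G i z).Returns F (H i z) 1)
    (hcl : IsClosed Z) (hcv : Convex ℝ Z) {μ Λ : ℝ}
    (hμ : 0 < μ) (hΛ : 0 < Λ) (hmono : StronglyMonotoneOn μ (avg H) Z)
    (hlip : ∀ i, ∀ z ∈ Z, ∀ z' ∈ Z, ‖H i z - H i z'‖ ≤ Λ * ‖z - z'‖) {zb : E}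
    (hzb : IsSVISolution (avg H) Z zb) (w wt : E) (hwt : wt ∈ Z) {η : ℝ}
    (hη : η = μ / (4 * (Λ + μ) ^ 2)) (s : ℕ) (z : E) (hz : z ∈ Z) :
    (svrgInner G Z μ η w wt (avg H wt - μ • (wt - w)) s z).mean F (fun r => ‖r - zb‖ ^ 2) ≤
      ‖wt - zb‖ ^ 2 / 2 + (1 + η * μ)⁻¹ ^ s * (‖z - zb‖ ^ 2 - ‖wt - zb‖ ^ 2 / 2) := by
  have hη0 : 0 < η := by rw [hη]; positivity
  induction s generalizing z with
  | zero => simp [svrgInner, monad_pure_eq, mean]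
  | succ s ih =>
    rw [mean_svrgInner_succ hG]
    have hstep := svrg_step hcl hcv hμ hΛ hmono hlip hzb w wt z hwt hz hη
    set f : Fin n → ℝ := fun i =>
      ‖resolvent η (opA μ w Z) (z - η • varianceReduced H μ w wt z i) - zb‖ ^ 2
    set W := ‖wt - zb‖ ^ 2
    have hW : 0 ≤ W := by positivity
    have hY : 0 ≤ ‖z - zb‖ ^ 2 := by positivity
    set q := (1 + η * μ)⁻¹ with hq
    have hn : (n : ℝ) ≠ 0 := Nat.cast_ne_zero.2 (NeZero.ne n)
    have hx : 0 < η * μ := by positivity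
    -- With x = ημ, both 1 + 3x/4 ≤ 1 + x and x/2 ≤ (1 + x)x/2, so one factor 1 + x cancels from the
    -- bound of `svrg_step`.
    have h1 : (n : ℝ)⁻¹ * ∑ i, f i ≤ W / 2 + q * (‖z - zb‖ ^ 2 - W / 2) := by
      have hx1 : 0 < 1 + η * μ := by positivity
      have e : W / 2 + q * (‖z - zb‖ ^ 2 - W / 2) = (‖z - zb‖ ^ 2 + η * μ / 2 * W) / (1 + η * μ) := by
        rw [hq]; field_simp; ring
      rw [e, le_div_iff₀ hx1]
      refine le_of_mul_le_mul_right ?_ hx1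
      nlinarith [mul_nonneg hx.le hY, mul_nonneg (sq_nonneg (η * μ)) hW]
    have h2 : (n : ℝ)⁻¹ * ∑ i, (W / 2 + q ^ s * (f i - W / 2)) =
        W / 2 + q ^ s * ((n : ℝ)⁻¹ * ∑ i, f i - W / 2) := by
      simp only [Finset.sum_add_distrib, ← Finset.mul_sum, Finset.sum_sub_distrib, Finset.sum_const,
        Finset.card_univ, Fintype.card_fin, nsmul_eq_mul]
      field_simp
    have h3 : (n : ℝ)⁻¹ * ∑ i, (svrgInner G Z μ η w wt (avg H wt - μ • (wt - w)) s
        (resolvent η (opA μ w Z) (z - η • varianceReduced H μ w wt z i))).mean F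
          (fun r => ‖r - zb‖ ^ 2) ≤ (n : ℝ)⁻¹ * ∑ i, (W / 2 + q ^ s * (f i - W / 2)) :=
      mul_le_mul_of_nonneg_left (Finset.sum_le_sum fun i _ =>
        ih _ (resolvent_mem ⟨z, hz⟩ hcl hcv hη0 hμ _ _)) (by positivity)
    rw [h2] at h3
    refine h3.trans ?_
    have hqs : 0 ≤ q ^ s := by positivity
    have h4 := mul_le_mul_of_nonneg_left h1 hqs
    rw [pow_succ]
    nlinarith

/-- Bernoulli's inequality gives (1 + x)^S ≥ 1 + Sx, and Sx ≥ log 4 ≥ 1. -/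
theorem inv_one_add_pow_le_half {x : ℝ} (hx : 0 < x) {S : ℕ} (hS : Real.log 4 / x ≤ S) :
    (1 + x)⁻¹ ^ S ≤ 1 / 2 := by
  have h1 := one_add_mul_le_pow (show -2 ≤ x by linarith) S
  have h2 : 1 ≤ S * x := by
    rw [div_le_iff₀ hx] at hS
    have h : (4 : ℝ) = 2 ^ 2 := by norm_num
    rw [h, Real.log_pow] at hS
    have := Real.log_two_gt_d9
    push_cast at hS
    linarith
  rw [inv_pow, one_div]
  exact inv_anti₀ two_pos (by linarith)

/-- The number of inner steps per epoch. -/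
def epochLength (μ Λ : ℝ) : ℕ := ⌈4 * Real.log 4 * (Λ + μ) ^ 2 / μ ^ 2⌉₊

theorem mean_svrgInner_epoch_le [CompleteSpace E] [NeZero n]
    (hG : ∀ i z, (G i z).Returns F (H i z) 1)
    (hcl : IsClosed Z) (hcv : Convex ℝ Z) {μ Λ : ℝ}
    (hμ : 0 < μ) (hΛ : 0 < Λ) (hmono : StronglyMonotoneOn μ (avg H) Z)
    (hlip : ∀ i, ∀ z ∈ Z, ∀ z' ∈ Z, ‖H i z - H i z'‖ ≤ Λ * ‖z - z'‖) {zb : E}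
    (hzb : IsSVISolution (avg H) Z zb) (w wt : E) (hwt : wt ∈ Z) {η : ℝ}
    (hη : η = μ / (4 * (Λ + μ) ^ 2)) :
    (svrgInner G Z μ η w wt (avg H wt - μ • (wt - w)) (epochLength μ Λ) wt).mean F
      (fun r => ‖r - zb‖ ^ 2) ≤ 3 / 4 * ‖wt - zb‖ ^ 2 := by
  refine (mean_svrgInner_le hG hcl hcv hμ hΛ hmono hlip hzb w wt hwt hη _ wt hwt).trans ?_
  have hη0 : 0 < η := by rw [hη]; positivity
  have h1 : (1 + η * μ)⁻¹ ^ epochLength μ Λ ≤ 1 / 2 := by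
    refine inv_one_add_pow_le_half (by positivity) ((le_of_eq ?_).trans (Nat.le_ceil _))
    rw [hη]
    field_simp
  -- The loop starts at the snapshot: 1/2 + (1/2)(1 - 1/2) = 3/4.
  nlinarith [sq_nonneg ‖wt - zb‖]

theorem post_svrgOuter [CompleteSpace E] [NeZero n] (hG : ∀ i z, (G i z).Returns F (H i z) 1)
    (hcl : IsClosed Z) (hcv : Convex ℝ Z) {μ η : ℝ} (hμ : 0 < μ) (hη : 0 < η) (w : E)
    (S t : ℕ) (wt : E) (hwt : wt ∈ Z) :
    (svrgOuter G Z μ η S w t wt).Post F (fun r m => r ∈ Z ∧ m = t * (n + 2 * S)) := by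
  induction t generalizing wt with
  | zero => exact ⟨hwt, by rw [Nat.zero_mul]⟩
  | succ t ih =>
    refine (returns_fullMap hG wt).post_bind (Post.bind ?_)
    refine (post_svrgInner hG hcl hcv hμ hη w wt (avg H wt) S wt hwt).mono fun r m h => ?_
    refine (ih r h.1).mono fun r' m' h' => ⟨h'.1, ?_⟩
    rw [h.2, h'.2]; ring

theorem mean_svrgOuter_le [CompleteSpace E] [NeZero n] (hG : ∀ i z, (G i z).Returns F (H i z) 1)
    (hcl : IsClosed Z) (hcv : Convex ℝ Z) {μ Λ : ℝ}
    (hμ : 0 < μ) (hΛ : 0 < Λ) (hmono : StronglyMonotoneOn μ (avg H) Z)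
    (hlip : ∀ i, ∀ z ∈ Z, ∀ z' ∈ Z, ‖H i z - H i z'‖ ≤ Λ * ‖z - z'‖) {zb : E}
    (hzb : IsSVISolution (avg H) Z zb) (w : E) {η : ℝ}
    (hη : η = μ / (4 * (Λ + μ) ^ 2)) (t : ℕ) (wt : E) (hwt : wt ∈ Z) :
    (svrgOuter G Z μ η (epochLength μ Λ) w t wt).mean F (fun r => ‖r - zb‖ ^ 2) ≤
      (3 / 4) ^ t * ‖wt - zb‖ ^ 2 := by
  have hη0 : 0 < η := by rw [hη]; positivity
  induction t generalizing wt with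
  | zero => simp [svrgOuter, monad_pure_eq, mean]
  | succ t ih =>
    rw [svrgOuter, monad_bind_eq, (returns_fullMap hG wt).mean_bind, monad_bind_eq, mean_bind]
    refine (mean_mono (post_svrgInner hG hcl hcv hμ hη0 w wt (avg H wt) _ wt hwt)
      fun r m h => ih r h.1).trans ?_
    rw [mean_const_mul, pow_succ, mul_assoc]
    exact mul_le_mul_of_nonneg_left
      (mean_svrgInner_epoch_le hG hcl hcv hμ hΛ hmono hlip hzb w wt hwt hη) (by positivity)

theorem post_svrg [CompleteSpace E] [NeZero n] (hG : ∀ i z, (G i z).Returns F (H i z) 1)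
    (hcl : IsClosed Z) (hcv : Convex ℝ Z) {μ Λ : ℝ} (hμ : 0 < μ) (hΛ : 0 < Λ) (w w0 : E)
    (hw0 : w0 ∈ Z) (T : ℕ) :
    (svrg G Z μ Λ w w0 T).Post F
      (fun r m => r ∈ Z ∧ m = T * (n + 2 * epochLength μ Λ) + n) := by
  refine Post.bind ((post_svrgOuter hG hcl hcv hμ (by positivity) w _ T w0 hw0).mono
    fun r m h => (returns_fullMap hG r).post_bind ?_)
  exact ⟨(proj_spec ⟨w0, hw0⟩ hcl hcv _).1, by rw [h.2]; rfl⟩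

theorem mean_svrg_le [CompleteSpace E] [NeZero n] (hG : ∀ i z, (G i z).Returns F (H i z) 1)
    (hcl : IsClosed Z) (hcv : Convex ℝ Z) {μ Λ : ℝ}
    (hμ : 0 < μ) (hΛ : 0 < Λ) (hmono : StronglyMonotoneOn μ (avg H) Z)
    (hlip : ∀ i, ∀ z ∈ Z, ∀ z' ∈ Z, ‖H i z - H i z'‖ ≤ Λ * ‖z - z'‖) {zb : E}
    (hzb : IsSVISolution (avg H) Z zb) (w w0 : E) (hw0 : w0 ∈ Z) (T : ℕ) :
    (svrg G Z μ Λ w w0 T).mean F (fun r => ‖r - zb‖ ^ 2) ≤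
      (2 + √2) ^ 2 / 4 * ((3 / 4) ^ T * ‖w0 - zb‖ ^ 2) := by
  rw [svrg, monad_bind_eq, mean_bind]
  have h2 : (√2 : ℝ) ^ 2 = 2 := Real.sq_sqrt (by norm_num)
  have hs2 : 0 < √2 := by positivity
  refine (mean_mono (g' := fun r => (2 + √2) ^ 2 / 4 * ‖r - zb‖ ^ 2)
    (post_svrgOuter hG hcl hcv hμ (by positivity) w _ T w0 hw0) fun r m h => ?_).trans ?_
  · rw [monad_bind_eq, (returns_fullMap hG r).mean_bind]
    have h1 := norm_proj_step_sub_le hcl hcv (c := (√2 * Λ)⁻¹) (by positivity) hzb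
      (norm_avg_sub_le hlip r h.1 zb hzb.1)
    -- The final projected step loses at most this factor, which the 2 + √2 inside the logarithm of
    -- T_k compensates.
    have h3 : 1 + (√2 * Λ)⁻¹ * Λ = (2 + √2) / 2 := by
      field_simp
      nlinarith
    rw [h3] at h1
    refine (pow_le_pow_left₀ (norm_nonneg _) h1 2).trans_eq ?_
    ring
  · rw [mean_const_mul]
    exact mul_le_mul_of_nonneg_left
      (mean_svrgOuter_le hG hcl hcv hμ hΛ hmono hlip hzb w rfl T w0 hw0) (by positivity)

end

/-! ### The inexact proximal point method -/

section


variable {E : Type} [NormedAddCommGroup E] [InnerProductSpace ℝ E] {Z : Set E} {n : ℕ}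
  {F : Fin n → E → E}

open Prog

theorem avg_proxMap [NeZero n] (F : Fin n → E → E) (γ : ℝ) (w : E) :
    avg (fun i => proxMap (F i) γ w) = proxMap (avg F) γ w := by
  have hn : (n : ℝ) ≠ 0 := Nat.cast_ne_zero.2 (NeZero.ne n)
  funext z
  simp only [avg, proxMap, Finset.sum_add_distrib, Finset.sum_const, Finset.card_univ,
    Fintype.card_fin, smul_add, ← Nat.cast_smul_eq_nsmul ℝ, smul_smul, inv_mul_cancel_left₀ hn]

theorem WeaklyMonotoneOn.proxMap {ρ γ : ℝ} {G : E → E} (hG : WeaklyMonotoneOn ρ G Z) (w : E) :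
    StronglyMonotoneOn (γ⁻¹ - ρ) (proxMap G γ w) Z := by
  intro z hz z' hz'
  have h1 : IPP.proxMap G γ w z - IPP.proxMap G γ w z' = (G z - G z') + γ⁻¹ • (z - z') := by
    simp only [IPP.proxMap]; module
  rw [h1, inner_add_left, real_inner_smul_left, real_inner_self_eq_norm_sq]
  linarith [hG z hz z' hz']

theorem norm_proxMap_sub_le {L γ : ℝ} (hγ : 0 < γ) {G : E → E} (w : E)
    (hG : ∀ z ∈ Z, ∀ z' ∈ Z, ‖G z - G z'‖ ≤ L * ‖z - z'‖) :
    ∀ z ∈ Z, ∀ z' ∈ Z, ‖proxMap G γ w z - proxMap G γ w z'‖ ≤ (L + γ⁻¹) * ‖z - z'‖ := by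
  intro z hz z' hz'
  have h1 : IPP.proxMap G γ w z - IPP.proxMap G γ w z' = (G z - G z') + γ⁻¹ • (z - z') := by
    simp only [IPP.proxMap]; module
  rw [h1]
  refine (norm_add_le _ _).trans ?_
  rw [norm_smul, Real.norm_of_nonneg (inv_pos.2 hγ).le]
  linarith [hG z hz z' hz']

/-- An exact proximal step decreases the distance to a Minty solution. -/
theorem IsSVISolution.norm_sub_minty_sq_le {G : E → E} {γ : ℝ} (hγ : 0 < γ) {w zb zs : E}
    (hzb : IsSVISolution (proxMap G γ w) Z zb) (hzs : IsMVISolution G Z zs) :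
    ‖zb - zs‖ ^ 2 + ‖w - zb‖ ^ 2 ≤ ‖w - zs‖ ^ 2 := by
  have h1 := hzb.2 zs hzs.1
  have h2 := hzs.2 zb hzb.1
  rw [proxMap, inner_add_left, real_inner_smul_left, ← neg_sub zb zs, inner_neg_right,
    inner_neg_right] at h1
  have h3 : inner ℝ (zb - w) (zb - zs) ≤ 0 := by
    by_contra! h
    nlinarith [mul_pos (inv_pos.2 hγ) h]
  have h4 : w - zs = (zb - zs) - (zb - w) := by abel
  rw [h4, norm_sub_sq_real (zb - zs), real_inner_comm, norm_sub_rev w zb]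
  linarith

/-- Here 3/4 = (√3/2)², and √3/2 ≤ exp(-(1 - √3/2)). -/
theorem three_quarters_pow_le {a : ℝ} (ha : 0 < a) {T : ℕ}
    (hT : (1 - √3 / 2)⁻¹ * Real.log a ≤ T) : (3 / 4 : ℝ) ^ T ≤ (a ^ 2)⁻¹ := by
  have h3 : (√3 : ℝ) ^ 2 = 3 := Real.sq_sqrt (by norm_num)
  have h30 : 0 ≤ √3 := Real.sqrt_nonneg 3
  have h1 : 0 < 1 - √3 / 2 := by nlinarith
  rw [inv_mul_le_iff₀ h1] at hT
  have h2 : (√3 / 2) ^ T ≤ a⁻¹ := by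
    calc (√3 / 2) ^ T ≤ Real.exp (-(1 - √3 / 2)) ^ T := by
          refine pow_le_pow_left₀ (by positivity) ?_ T
          have := Real.add_one_le_exp (-(1 - √3 / 2))
          linarith
      _ = Real.exp (-((1 - √3 / 2) * T)) := by rw [← Real.exp_nat_mul]; ring_nf
      _ ≤ Real.exp (-Real.log a) := Real.exp_le_exp.2 (by linarith)
      _ = a⁻¹ := by rw [Real.exp_neg, Real.exp_log ha]
  calc (3 / 4 : ℝ) ^ T = ((√3 / 2) ^ T) ^ 2 := by
        rw [pow_right_comm]; congr 1; rw [div_pow, h3]; norm_num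
    _ ≤ a⁻¹ ^ 2 := pow_le_pow_left₀ (by positivity) h2 2
    _ = _ := inv_pow _ _

section Loop

variable {approx : ℕ → E → Prog n E E} {c : ℕ → ℕ} {bar : E → E} {zs : E} {D : ℝ}

/-- One inexact proximal step decreases the mean squared distance to the Minty solution `zs`. -/
theorem mean_stage_le {p : Prog n E E} {k : ℕ} {z zb : E}
    (hp : p.Post F (fun r _ => r ∈ Z))
    (hmean : p.mean F (fun r => ‖r - zb‖ ^ 2) ≤ ‖z - zb‖ ^ 2 / (4 * (k + 1) ^ 2))
    (hbar : ‖zb - zs‖ ^ 2 + ‖z - zb‖ ^ 2 ≤ ‖z - zs‖ ^ 2) (hD : ‖zb - zs‖ ≤ D) :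
    p.mean F (fun r => ‖r - zs‖ ^ 2) + ‖z - zb‖ ^ 2 / 2 ≤ ‖z - zs‖ ^ 2 + D ^ 2 / (k + 1) := by
  have hk : (0 : ℝ) < k + 1 := by positivity
  -- Young's inequality with parameter 1/(k+1), the rate matched to the inner accuracy:
  -- (k+2)/(4(k+1)²) ≤ 1/2.
  have h1 : p.mean F (fun r => ‖r - zs‖ ^ 2) ≤
      ((k : ℝ) + 2) * p.mean F (fun r => ‖r - zb‖ ^ 2) + (1 + 1 / (k + 1)) * ‖zb - zs‖ ^ 2 := by
    rw [← mean_affine]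
    refine mean_mono hp fun r _ _ => ?_
    have h2 : ‖r - zs‖ ≤ ‖r - zb‖ + ‖zb - zs‖ := norm_sub_le_norm_sub_add_norm_sub _ _ _
    have h3 := pow_le_pow_left₀ (norm_nonneg _) h2 2
    refine h3.trans ?_
    have h4 : ((k : ℝ) + 2) * ‖r - zb‖ ^ 2 + (1 + 1 / (k + 1)) * ‖zb - zs‖ ^ 2 -
        (‖r - zb‖ + ‖zb - zs‖) ^ 2 = ((k + 1) * ‖r - zb‖ - ‖zb - zs‖) ^ 2 / (k + 1) := by
      field_simp
      ring
    have h5 : 0 ≤ ((k + 1) * ‖r - zb‖ - ‖zb - zs‖) ^ 2 / (k + 1 : ℝ) := by positivity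
    linarith
  have h2 : ((k : ℝ) + 2) * p.mean F (fun r => ‖r - zb‖ ^ 2) ≤ ‖z - zb‖ ^ 2 / 2 := by
    refine (mul_le_mul_of_nonneg_left hmean (by positivity)).trans ?_
    rw [← mul_div_assoc, div_le_div_iff₀ (by positivity) two_pos]
    nlinarith [sq_nonneg ‖z - zb‖, mul_nonneg (sq_nonneg ‖z - zb‖) (sq_nonneg (k : ℝ)),
      mul_nonneg (sq_nonneg ‖z - zb‖) (Nat.cast_nonneg (α := ℝ) k)]
  have h3 : 1 / (k + 1 : ℝ) * ‖zb - zs‖ ^ 2 ≤ D ^ 2 / (k + 1) := by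
    rw [one_div_mul_eq_div]
    exact div_le_div_of_nonneg_right (pow_le_pow_left₀ (norm_nonneg _) hD 2) hk.le
  linarith

theorem post_ippLoop
    (hpost : ∀ k, ∀ z ∈ Z, (approx k z).Post F (fun r m => r ∈ Z ∧ m = c k))
    {z0 : E} (hz0 : z0 ∈ Z) (k : ℕ) :
    (ippLoop approx z0 k).Post F
      (fun h m => (∀ j, h j ∈ Z) ∧ m = ∑ j ∈ Finset.range k, c j) := by
  induction k with
  -- The initial history is constantly `z0`, so feasibility holds at every index, including stages
  -- not yet reached.
  | zero => exact ⟨fun _ => hz0, rfl⟩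
  | succ k ih =>
    refine Post.bind (ih.mono fun h m hm => Post.bind ((hpost k _ (hm.1 k)).mono fun r m' hr => ?_))
    refine ⟨fun j => ?_, ?_⟩
    · rcases eq_or_ne j (k + 1) with rfl | hj
      · rw [Function.update_self]; exact hr.1
      · rw [Function.update_of_ne hj]; exact hm.1 j
    · rw [Finset.sum_range_succ, hm.2, hr.2]; rfl

theorem rpow_add_one_le_sub {α : ℝ} (hα : 1 < α) (k : ℕ) :
    ((k : ℝ) + 1) ^ (α - 1) ≤ ((k : ℝ) + 1) ^ α - (k : ℝ) ^ α := by
  have hk : (0 : ℝ) < k + 1 := by positivity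
  have h1 : ((k : ℝ) + 1) ^ α = (k + 1) * ((k : ℝ) + 1) ^ (α - 1) := by
    rw [Real.rpow_sub_one hk.ne']; field_simp
  have h2 : (k : ℝ) ^ α ≤ k * ((k : ℝ) + 1) ^ (α - 1) := by
    rcases Nat.eq_zero_or_pos k with rfl | hk0
    · simp [Real.zero_rpow (by linarith : α ≠ 0)]
    · have hk' : (0 : ℝ) < k := Nat.cast_pos.2 hk0
      have : (k : ℝ) ^ α = k * (k : ℝ) ^ (α - 1) := by
        rw [Real.rpow_sub_one hk'.ne']; field_simp
      rw [this]
      exact mul_le_mul_of_nonneg_left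
        (Real.rpow_le_rpow hk'.le (by linarith) (by linarith)) hk'.le
  rw [h1]
  nlinarith

/-- Stage k raises the bound by at most ((k+1)^α - k^α)D² from the change of weight and
(k+1)^(α-1)D² from inexactness. The second is at most the first, so the sum telescopes to 2K^α D².
-/
theorem mean_ippLoop_potential_le {α : ℝ} (hα : 1 < α)
    (hpost : ∀ k, ∀ z ∈ Z, (approx k z).Post F (fun r m => r ∈ Z ∧ m = c k))
    (hmean : ∀ k, ∀ z ∈ Z,
      (approx k z).mean F (fun r => ‖r - bar z‖ ^ 2) ≤ ‖z - bar z‖ ^ 2 / (4 * (k + 1) ^ 2))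
    (hbar : ∀ z ∈ Z, bar z ∈ Z ∧ ‖bar z - zs‖ ^ 2 + ‖z - bar z‖ ^ 2 ≤ ‖z - zs‖ ^ 2)
    (hD : ∀ z ∈ Z, ‖z - zs‖ ≤ D) {z0 : E} (hz0 : z0 ∈ Z) (k : ℕ) :
    (ippLoop approx z0 k).mean F (fun h =>
      ∑ j ∈ Finset.range k, ((j : ℝ) + 1) ^ α * (‖h j - bar (h j)‖ ^ 2 / 2) +
        (k : ℝ) ^ α * ‖h k - zs‖ ^ 2) ≤ 2 * (k : ℝ) ^ α * D ^ 2 := by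
  induction k with
  | zero => simp [ippLoop, monad_pure_eq, mean, Real.zero_rpow (by linarith : α ≠ 0)]
  | succ k ih =>
    have hk : (0 : ℝ) < k + 1 := by positivity
    set a : ℝ := ((k : ℝ) + 1) ^ α with ha
    set b : ℝ := ((k : ℝ) + 1) ^ (α - 1) with hb
    set a' : ℝ := (k : ℝ) ^ α with ha'
    have hab : b ≤ a - a' := rpow_add_one_le_sub hα k
    have hb0 : 0 ≤ b := by positivity
    have ha0 : 0 ≤ a := by positivity
    have hba : a * (D ^ 2 / (k + 1)) = b * D ^ 2 := by
      rw [ha, hb, Real.rpow_sub_one hk.ne']; field_simp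
    rw [ippLoop, monad_bind_eq, mean_bind]
    refine (mean_mono (post_ippLoop hpost hz0 k) (g' := fun h =>
      1 * (∑ j ∈ Finset.range k, ((j : ℝ) + 1) ^ α * (‖h j - bar (h j)‖ ^ 2 / 2) +
        a' * ‖h k - zs‖ ^ 2) + ((a - a') + b) * D ^ 2) fun h m hm => ?_).trans ?_
    · have hz := hm.1 k
      rw [monad_bind_eq, mean_bind]
      have hs := mean_stage_le ((hpost k _ hz).mono fun r m h => h.1) (hmean k _ hz)
        (hbar _ hz).2 (hD _ (hbar _ hz).1)
      have hA := pow_le_pow_left₀ (norm_nonneg _) (hD _ hz) 2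
      set S := ∑ j ∈ Finset.range k, ((j : ℝ) + 1) ^ α * (‖h j - bar (h j)‖ ^ 2 / 2)
      have e : ∀ z', (pure (Function.update h (k + 1) z') : Prog n E (ℕ → E)).mean F (fun h =>
          ∑ j ∈ Finset.range (k + 1), ((j : ℝ) + 1) ^ α * (‖h j - bar (h j)‖ ^ 2 / 2) +
          ((k + 1 : ℕ) : ℝ) ^ α * ‖h (k + 1) - zs‖ ^ 2) =
          a * ‖z' - zs‖ ^ 2 + (S + a * (‖h k - bar (h k)‖ ^ 2 / 2)) := by
        intro z'
        rw [monad_pure_eq, mean, Function.update_self, add_comm, Finset.sum_range_succ,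
          Function.update_of_ne (Nat.lt_succ_self k).ne]
        push_cast
        congr 2
        refine Finset.sum_congr rfl fun j hj => ?_
        rw [Function.update_of_ne (by have := Finset.mem_range.1 hj; omega)]
      simp only [e]
      rw [mean_affine]
      have h1 := mul_le_mul_of_nonneg_left hs ha0
      have h2 : (a - a') * ‖h k - zs‖ ^ 2 ≤ (a - a') * D ^ 2 :=
        mul_le_mul_of_nonneg_left hA (hb0.trans hab)
      rw [mul_add, mul_add, hba] at h1
      linarith
    · rw [mean_affine]
      have := mul_le_mul_of_nonneg_right hab (sq_nonneg D)
      push_cast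
      linarith

/-- Bernoulli's inequality at -1/(k+1) gives (k+1)^(α+1) - k^(α+1) ≤ (α+1)(k+1)^α, which is summed.
-/
theorem rpow_le_mul_sum {α : ℝ} (hα : 0 ≤ α) (K : ℕ) :
    (K : ℝ) ^ (α + 1) ≤ (α + 1) * ∑ l ∈ Finset.range K, ((l : ℝ) + 1) ^ α := by
  induction K with
  | zero => simp [Real.zero_rpow (by linarith : α + 1 ≠ 0)]
  | succ k ih =>
    have hk : (0 : ℝ) < k + 1 := by positivity
    rw [Finset.sum_range_succ, mul_add]
    have h1 := one_add_mul_self_le_rpow_one_add (s := -(1 / ((k : ℝ) + 1))) (p := α + 1)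
      (by rw [neg_le_neg_iff, div_le_one hk]; linarith [Nat.cast_nonneg (α := ℝ) k]) (by linarith)
    have h2 : 1 + -(1 / ((k : ℝ) + 1)) = k / (k + 1) := by field_simp; ring
    rw [h2, Real.div_rpow (Nat.cast_nonneg k) hk.le, le_div_iff₀ (by positivity)] at h1
    have h3 : (1 + (α + 1) * -(1 / ((k : ℝ) + 1))) * ((k : ℝ) + 1) ^ (α + 1) =
        ((k : ℝ) + 1) ^ (α + 1) - (α + 1) * ((k : ℝ) + 1) ^ α := by
      rw [Real.rpow_add_one hk.ne']; field_simp; ring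
    push_cast
    linarith

theorem stageLaw_apply_toReal (α : ℝ) (K : ℕ) [NeZero K] (k : Fin K) :
    (stageLaw α K k).toReal =
      (((k : ℕ) : ℝ) + 1) ^ α / ∑ l ∈ Finset.range K, ((l : ℝ) + 1) ^ α := by
  rw [stageLaw, PMF.normalize_apply, tsum_fintype, ENNReal.toReal_mul, ENNReal.toReal_inv,
    ENNReal.toReal_sum (fun _ _ => ENNReal.ofReal_ne_top), ENNReal.toReal_ofReal (by positivity),
    ← div_eq_mul_inv, Finset.sum_range]
  congr 1
  exact Finset.sum_congr rfl fun l _ => ENNReal.toReal_ofReal (by positivity)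

theorem mean_ipp_le {α : ℝ} (hα : 1 < α) {K : ℕ} [NeZero K]
    (hpost : ∀ k, ∀ z ∈ Z, (approx k z).Post F (fun r m => r ∈ Z ∧ m = c k))
    (hmean : ∀ k, ∀ z ∈ Z,
      (approx k z).mean F (fun r => ‖r - bar z‖ ^ 2) ≤ ‖z - bar z‖ ^ 2 / (4 * (k + 1) ^ 2))
    (hbar : ∀ z ∈ Z, bar z ∈ Z ∧ ‖bar z - zs‖ ^ 2 + ‖z - bar z‖ ^ 2 ≤ ‖z - zs‖ ^ 2)
    (hD : ∀ z ∈ Z, ‖z - zs‖ ≤ D) {z0 : E} (hz0 : z0 ∈ Z) :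
    (ipp approx (stageLaw α K) z0).mean F (fun z => ‖z - bar z‖ ^ 2) ≤
      4 * (α + 1) * D ^ 2 / K := by
  have hK : (0 : ℝ) < K := Nat.cast_pos.2 (NeZero.pos K)
  set W : ℝ := ∑ l ∈ Finset.range K, ((l : ℝ) + 1) ^ α with hW
  have hW1 : (K : ℝ) ^ (α + 1) ≤ (α + 1) * W := rpow_le_mul_sum (by linarith) K
  have hKa : 0 < (K : ℝ) ^ α := by positivity
  have hW0 : 0 < W := by
    have : 0 < (K : ℝ) ^ (α + 1) := by positivity
    by_contra! h
    nlinarith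
  rw [ipp, monad_bind_eq, mean_bind]
  refine (mean_mono (post_ippLoop hpost hz0 K) (g' := fun h => 2 / W *
    (∑ j ∈ Finset.range K, ((j : ℝ) + 1) ^ α * (‖h j - bar (h j)‖ ^ 2 / 2) +
        (K : ℝ) ^ α * ‖h K - zs‖ ^ 2)) fun h m hm => ?_).trans ?_
  · have e : ((sample (stageLaw α K) : Prog n E (Fin K)) >>= fun τ => pure (h (τ : ℕ))).mean F
        (fun z => ‖z - bar z‖ ^ 2) =
        ∑ j : Fin K, (stageLaw α K j).toReal * ‖h j - bar (h j)‖ ^ 2 := rfl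
    rw [e]
    simp only [stageLaw_apply_toReal]
    rw [← hW, ← Finset.sum_range (fun j : ℕ => ((j : ℝ) + 1) ^ α / W * ‖h j - bar (h j)‖ ^ 2), mul_add,
      Finset.mul_sum]
    have h1 : 0 ≤ 2 / W * ((K : ℝ) ^ α * ‖h K - zs‖ ^ 2) := by positivity
    have h2 : ∀ j : ℕ, ((j : ℝ) + 1) ^ α / W * ‖h j - bar (h j)‖ ^ 2 =
        2 / W * (((j : ℝ) + 1) ^ α * (‖h j - bar (h j)‖ ^ 2 / 2)) := fun j => by ring
    simp only [h2]
    linarith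
  · rw [mean_const_mul]
    have h1 := mean_ippLoop_potential_le hα hpost hmean hbar hD hz0 K
    refine (mul_le_mul_of_nonneg_left h1 (by positivity)).trans ?_
    rw [Real.rpow_add_one hK.ne'] at hW1
    rw [div_mul_eq_mul_div, div_le_div_iff₀ hW0 hK]
    nlinarith [mul_le_mul_of_nonneg_right hW1 (sq_nonneg D)]

theorem post_ipp {K : ℕ}
    (hpost : ∀ k, ∀ z ∈ Z, (approx k z).Post F (fun r m => r ∈ Z ∧ m = c k))
    (τLaw : PMF (Fin K)) {z0 : E} (hz0 : z0 ∈ Z) :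
    (ipp approx τLaw z0).Post F (fun z m => z ∈ Z ∧ m = ∑ j ∈ Finset.range K, c j) :=
  Post.bind ((post_ippLoop hpost hz0 K).mono fun _ _ h j => ⟨h.1 j, h.2⟩)

end Loop

end

/-! ### SVRG as inner solver, query count and stationarity -/

section


section Solver

variable {E : Type} [NormedAddCommGroup E] [InnerProductSpace ℝ E] [CompleteSpace E] {Z : Set E}
  {n : ℕ} [NeZero n] {F : Fin n → E → E}

open Prog

theorem exists_proxMap_solution (hne : Z.Nonempty) (hcl : IsClosed Z) (hcv : Convex ℝ Z)
    {ρ γ L : ℝ} (hγ : 0 < γ) (hργ : ρ < γ⁻¹) (hL : 0 ≤ L) (hmono : WeaklyMonotoneOn ρ (avg F) Z)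
    (hlip : ∀ i, ∀ z ∈ Z, ∀ z' ∈ Z, ‖F i z - F i z'‖ ≤ L * ‖z - z'‖) (w : E) :
    ∃ b, ∀ z, IsSVISolution (proxMap (avg F) γ w) Z z ↔ z = b := by
  have hμ : 0 < γ⁻¹ - ρ := sub_pos.2 hργ
  have hsm := hmono.proxMap (γ := γ) w
  obtain ⟨b, hb⟩ := hsm.exists_svi hne hcl hcv hμ (by positivity)
    (norm_proxMap_sub_le hγ w (norm_avg_sub_le hlip))
  exact ⟨b, fun z => ⟨fun hz => hsm.svi_unique hμ hz hb, fun h => h ▸ hb⟩⟩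

theorem mean_svrg_proxComponent_le (hcl : IsClosed Z) (hcv : Convex ℝ Z) {ρ γ L : ℝ} (hρ : 0 < ρ)
    (hρL : ρ ≤ L) (hγ : 0 < γ) (hργ : ρ < γ⁻¹) (hmono : WeaklyMonotoneOn ρ (avg F) Z)
    (hlip : ∀ i, ∀ z ∈ Z, ∀ z' ∈ Z, ‖F i z - F i z'‖ ≤ L * ‖z - z'‖) {k T : ℕ}
    (hT : (1 - √3 / 2)⁻¹ * Real.log ((2 + √2) * L * (k + 1) / ρ) ≤ T) (w : E) {z zb : E}
    (hz : z ∈ Z) (hzb : IsSVISolution (proxMap (avg F) γ z) Z zb) :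
    (svrg (proxComponent γ z) Z (γ⁻¹ - ρ) (L + γ⁻¹) w z T).mean F (fun r => ‖r - zb‖ ^ 2) ≤
      ‖z - zb‖ ^ 2 / (4 * (k + 1) ^ 2) := by
  have hL : 0 < L := hρ.trans_le hρL
  rw [← avg_proxMap] at hzb
  have h := mean_svrg_le (H := fun i => proxMap (F i) γ z) (returns_proxComponent γ z) hcl hcv
    (sub_pos.2 hργ) (show 0 < L + γ⁻¹ by positivity)
    (by rw [avg_proxMap]; exact hmono.proxMap z)
    (fun i => norm_proxMap_sub_le hγ z (hlip i)) hzb w z hz T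
  have h1 := three_quarters_pow_le (by positivity) hT
  -- The loss of the projected step cancels; the factor (ρ/L)² that remains is at most 1.
  have h2 : (2 + √2) ^ 2 / 4 * (((2 + √2) * L * (k + 1) / ρ) ^ 2)⁻¹ ≤ 1 / (4 * (k + 1) ^ 2) := by
    have e : (2 + √2) ^ 2 / 4 * (((2 + √2) * L * (k + 1) / ρ) ^ 2)⁻¹ =
        (ρ / L) ^ 2 / (4 * (k + 1) ^ 2) := by field_simp
    rw [e]
    exact div_le_div_of_nonneg_right
      (pow_le_one₀ (by positivity) ((div_le_one hL).2 hρL)) (by positivity)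
  rw [← mul_assoc] at h
  refine h.trans ((mul_le_mul_of_nonneg_right ?_ (sq_nonneg ‖z - zb‖)).trans_eq
    (one_div_mul_eq_div _ _))
  exact (mul_le_mul_of_nonneg_left h1 (by positivity)).trans h2

theorem post_svrg_proxComponent (hcl : IsClosed Z) (hcv : Convex ℝ Z) {ρ γ L : ℝ}
    (hγ : 0 < γ) (hργ : ρ < γ⁻¹) (hL : 0 ≤ L) (T : ℕ) (w : E) {z : E} (hz : z ∈ Z) :
    (svrg (proxComponent γ z) Z (γ⁻¹ - ρ) (L + γ⁻¹) w z T).Post F (fun r m =>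
      r ∈ Z ∧ m = T * (n + 2 * epochLength (γ⁻¹ - ρ) (L + γ⁻¹)) + n) :=
  post_svrg (returns_proxComponent γ z) hcl hcv (sub_pos.2 hργ) (add_pos_of_nonneg_of_pos hL (inv_pos.2 hγ)) w z hz T

theorem post_ippSVRG (hcl : IsClosed Z) (hcv : Convex ℝ Z) {ρ γ L : ℝ}
    (hγ : 0 < γ) (hργ : ρ < γ⁻¹) (hL : 0 ≤ L) (T : ℕ → ℕ) {K : ℕ} (τLaw : PMF (Fin K))
    (ref : ℕ → E → E) {z0 : E} (hz0 : z0 ∈ Z) :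
    (ippSVRG Z γ ρ L T τLaw ref z0).Post F (fun z m => z ∈ Z ∧
      m = ∑ k ∈ Finset.range K, (T k * (n + 2 * epochLength (γ⁻¹ - ρ) (L + γ⁻¹)) + n)) :=
  post_ipp (fun k z hz => post_svrg_proxComponent hcl hcv hγ hργ hL (T k) (ref k z) hz) τLaw hz0

theorem mean_ippSVRG_le {α : ℝ} (hα : 1 < α) (hcl : IsClosed Z) (hcv : Convex ℝ Z)
    {ρ γ L D : ℝ} (hρ : 0 < ρ) (hρL : ρ ≤ L) (hγ : 0 < γ) (hργ : ρ < γ⁻¹)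
    (hD : ∀ z ∈ Z, ∀ z' ∈ Z, ‖z - z'‖ ≤ D)
    (hlip : ∀ i, ∀ z ∈ Z, ∀ z' ∈ Z, ‖F i z - F i z'‖ ≤ L * ‖z - z'‖)
    (hmono : WeaklyMonotoneOn ρ (avg F) Z) {zs : E} (hzs : IsMVISolution (avg F) Z zs)
    {bar : E → E} (hbar : ∀ w ∈ Z, IsSVISolution (proxMap (avg F) γ w) Z (bar w)) {T : ℕ → ℕ}
    (hT : ∀ k : ℕ, (1 - √3 / 2)⁻¹ * Real.log ((2 + √2) * L * (k + 1) / ρ) ≤ T k)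
    {K : ℕ} [NeZero K] (ref : ℕ → E → E) {z0 : E} (hz0 : z0 ∈ Z) :
    (ippSVRG Z γ ρ L T (stageLaw α K) ref z0).mean F (fun z => ‖z - bar z‖ ^ 2) ≤
      4 * (α + 1) * D ^ 2 / K :=
  mean_ipp_le hα
    (fun k z hz =>
      post_svrg_proxComponent hcl hcv hγ hργ (hρ.le.trans hρL) (T k) (ref k z) hz)
    (fun k z hz =>
      mean_svrg_proxComponent_le hcl hcv hρ hρL hγ hργ hmono hlip (hT k) (ref k z) hz (hbar z hz))
    (fun z hz => ⟨(hbar z hz).1, (hbar z hz).norm_sub_minty_sq_le hγ hzs⟩)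
    (fun z hz => hD z hz zs hzs.1) hz0

end Solver

/-! ### Query count -/

theorem log_four_lt : Real.log 4 < 7 / 5 := by
  have h : (4 : ℝ) = 2 ^ 2 := by norm_num
  rw [h, Real.log_pow]
  have := Real.log_two_lt_d9
  push_cast
  linarith

theorem epochLength_le {ρ L : ℝ} (hρ : 0 < ρ) (hρL : ρ ≤ L) :
    (epochLength ρ (L + 2 * ρ) : ℝ) ≤ 91 * (L ^ 2 / ρ ^ 2) := by
  have hR : 1 ≤ L / ρ := (one_le_div hρ).2 hρL
  have hlog : 0 ≤ Real.log 4 := Real.log_nonneg (by norm_num)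
  have h1 := Nat.ceil_lt_add_one
    (show 0 ≤ 4 * Real.log 4 * (L + 2 * ρ + ρ) ^ 2 / ρ ^ 2 by positivity)
  have h2 : 4 * Real.log 4 * (L + 2 * ρ + ρ) ^ 2 / ρ ^ 2 = 4 * Real.log 4 * (L / ρ + 3) ^ 2 := by
    field_simp; ring
  rw [epochLength, ← div_pow]
  -- As L/ρ ≥ 1, 4 · 7/5 · 16 = 89.6, and the 1 from the ceiling fits under 91.
  have h3 : (L / ρ + 3) ^ 2 ≤ 16 * (L / ρ) ^ 2 := by nlinarith
  have h4 : Real.log 4 * (L / ρ + 3) ^ 2 ≤ 7 / 5 * (16 * (L / ρ) ^ 2) :=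
    mul_le_mul log_four_lt.le h3 (by positivity) (by norm_num)
  rw [h2] at h1 ⊢
  nlinarith

theorem epochs_le {R : ℝ} (hR : 1 ≤ R) {k K : ℕ} (hk : k < K) :
    (⌈(1 - √3 / 2)⁻¹ * Real.log ((2 + √2) * R * (k + 1))⌉₊ : ℝ) ≤
      13 + 8 * Real.log R + 8 * Real.log K := by
  have hR0 : 0 < R := by linarith
  have h3 : √3 ≤ 7 / 4 := Real.sqrt_le_iff.2 ⟨by norm_num, by norm_num⟩
  have h2 : √2 ≤ 2 := Real.sqrt_le_iff.2 ⟨by norm_num, by norm_num⟩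
  have h20 : 0 ≤ √2 := Real.sqrt_nonneg 2
  have hk1 : (k : ℝ) + 1 ≤ K := by exact_mod_cast hk
  have hk0 : (0 : ℝ) ≤ k := Nat.cast_nonneg k
  have hK : (0 : ℝ) < K := by linarith
  have hlog : Real.log ((2 + √2) * R * (k + 1)) ≤ Real.log 4 + Real.log R + Real.log K := by
    rw [← Real.log_mul (by norm_num) hR0.ne', ← Real.log_mul (by positivity) hK.ne']
    refine Real.log_le_log (by positivity) ?_
    gcongr
    linarith
  have hlog0 : 0 ≤ Real.log ((2 + √2) * R * (k + 1)) := by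
    refine Real.log_nonneg ?_
    nlinarith [mul_nonneg h20 hR0.le, mul_nonneg hR0.le hk0, mul_nonneg (mul_nonneg h20 hR0.le) hk0]
  have hc : (1 - √3 / 2)⁻¹ ≤ 8 := by
    rw [inv_le_comm₀ (by linarith) (by norm_num)]
    linarith
  have hc0 : 0 ≤ (1 - √3 / 2)⁻¹ := inv_nonneg.2 (by linarith)
  have h4 := Nat.ceil_lt_add_one (mul_nonneg hc0 hlog0)
  have h5 : (1 - √3 / 2)⁻¹ * Real.log ((2 + √2) * R * (k + 1)) ≤
      8 * (Real.log 4 + Real.log R + Real.log K) :=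
    mul_le_mul hc hlog hlog0 (by norm_num)
  linarith [log_four_lt]

/-- The constant in the bound on the number of queries. -/
def complexityConst (α : ℝ) : ℝ := (6 * α + 7) * (182 * (16 + 8 * Real.log (6 * α + 7)) + 1)

theorem complexityConst_pos {α : ℝ} (hα : 1 < α) : 0 < complexityConst α := by
  have : 0 ≤ Real.log (6 * α + 7) := Real.log_nonneg (by linarith)
  rw [complexityConst]
  positivity

theorem query_count_le {α : ℝ} (hα : 1 < α) {n : ℕ} {ρ L D ε : ℝ} (hρ : 0 < ρ)
    (hρL : ρ ≤ L) (hε : 0 < ε) (hεD : ε ≤ D) {K : ℕ}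
    (hK : K = ⌈6 * D ^ 2 * (α + 1) / ε ^ 2⌉₊) {T : ℕ → ℕ}
    (hT : ∀ k : ℕ, T k = ⌈(1 - √3 / 2)⁻¹ * Real.log ((2 + √2) * L * (k + 1) / ρ)⌉₊) :
    ((∑ k ∈ Finset.range K, (T k * (n + 2 * epochLength ρ (L + 2 * ρ)) + n) : ℕ) : ℝ) ≤
      complexityConst α * (D ^ 2 * (n + L ^ 2 / ρ ^ 2) / ε ^ 2)
        * (1 + Real.log (L / ρ) + Real.log (D / ε)) := by
  have hR : 1 ≤ L / ρ := (one_le_div hρ).2 hρL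
  have hr : 1 ≤ D / ε := (one_le_div hε).2 hεD
  have hS := epochLength_le hρ hρL
  rw [← div_pow] at hS ⊢
  have hD : D ^ 2 * (n + (L / ρ) ^ 2) / ε ^ 2 = (D / ε) ^ 2 * (n + (L / ρ) ^ 2) := by
    rw [div_pow D]; ring
  rw [hD]
  have hM : 1 ≤ 6 * α + 7 := by linarith
  have hlM : 0 ≤ Real.log (6 * α + 7) := Real.log_nonneg hM
  have hlR : 0 ≤ Real.log (L / ρ) := Real.log_nonneg hR
  have hlr : 0 ≤ Real.log (D / ε) := Real.log_nonneg hr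
  have hKr : 6 * D ^ 2 * (α + 1) / ε ^ 2 = 6 * (α + 1) * (D / ε) ^ 2 := by
    rw [div_pow]; ring
  rw [hKr] at hK
  have hpos : 0 < 6 * (α + 1) * (D / ε) ^ 2 := by positivity
  have hK0 : (0 : ℝ) < K := by
    rw [hK]; exact Nat.cast_pos.2 (Nat.ceil_pos.2 hpos)
  -- The 1 from the ceiling is absorbed because ε ≤ D.
  have hK1 : (K : ℝ) ≤ (6 * α + 7) * (D / ε) ^ 2 := by
    have := Nat.ceil_lt_add_one hpos.le
    rw [← hK] at this
    nlinarith
  have hlK : Real.log K ≤ Real.log (6 * α + 7) + 2 * Real.log (D / ε) := by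
    refine (Real.log_le_log hK0 hK1).trans_eq ?_
    rw [Real.log_mul (by positivity) (by positivity), Real.log_pow]
    norm_num
  generalize hRdef : L / ρ = R at *
  generalize hrdef : D / ε = r at *
  generalize hldef : 1 + Real.log R + Real.log r = l
  generalize hMdef : 6 * α + 7 = M at *
  have hl1 : 1 ≤ l := by linarith
  have hterm : ∀ k ∈ Finset.range K,
      ((T k * (n + 2 * epochLength ρ (L + 2 * ρ)) + n : ℕ) : ℝ) ≤
        (182 * (16 + 8 * Real.log M) + 1) * ((n + R ^ 2) * l) := by
    intro k hk
    have h1 : (T k : ℝ) ≤ (16 + 8 * Real.log M) * l := by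
      have h2 := epochs_le hR (Finset.mem_range.1 hk)
      have h3 : (2 + √2) * L * (k + 1) / ρ = (2 + √2) * R * (k + 1) := by
        rw [← hRdef]; ring
      rw [← h3, ← hT] at h2
      nlinarith
    -- An epoch costs n queries for the snapshot and two per inner step, whence 2 · 91.
    have h4 : (n : ℝ) + 2 * epochLength ρ (L + 2 * ρ) ≤ 182 * (n + R ^ 2) := by
      linarith [Nat.cast_nonneg (α := ℝ) n]
    have h5 := mul_le_mul h1 h4 (by positivity) (by positivity)
    have h6 : (n : ℝ) ≤ (n + R ^ 2) * l := by
      nlinarith [Nat.cast_nonneg (α := ℝ) n, sq_nonneg R]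
    push_cast
    linarith
  rw [Nat.cast_sum]
  refine (Finset.sum_le_card_nsmul _ _ _ hterm).trans ?_
  rw [Finset.card_range, nsmul_eq_mul, complexityConst, hMdef]
  have h7 : 0 ≤ (182 * (16 + 8 * Real.log M) + 1) * ((n + R ^ 2) * l) := by positivity
  refine (mul_le_mul_of_nonneg_right hK1 h7).trans_eq ?_
  ring

/-! ### Fréchet subdifferentials of constrained functions -/

theorem add_mem_frechetSubdiff_indicatorTop {E : Type} [NormedAddCommGroup E]
    [InnerProductSpace ℝ E] {h : E → ℝ} {S : Set E} {x ζ ν : E}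
    (hζ : ζ ∈ frechetSubdiff (fun x => (h x : WithTop ℝ)) x) (hν : ν ∈ normalCone S x) :
    ζ + ν ∈ frechetSubdiff (fun x => (h x : WithTop ℝ) + indicatorTop S x) x := by
  have hx : indicatorTop S x = 0 := if_pos hν.1
  refine ⟨by simp [hx], fun δ hδ => ?_⟩
  filter_upwards [hζ.2 δ hδ] with y hy
  by_cases hyS : y ∈ S
  · have h0 : indicatorTop S y = 0 := if_pos hyS
    simp only [hx, h0, add_zero] at hy ⊢
    rw [← WithTop.coe_add, WithTop.coe_le_coe] at hy ⊢
    rw [inner_add_left]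
    linarith [hν.2 y hyS]
  · have h0 : indicatorTop S y = ⊤ := if_neg hyS
    simp [h0]

variable {p q : ℕ} {X : Set (Vec p)} {Y : Set (Vec q)}

theorem isClosed_feasible (hX : IsClosed X) (hY : IsClosed Y) : IsClosed (feasible X Y) :=
  (hX.preimage (WithLp.continuous_fst 2 _ _)).inter (hY.preimage (WithLp.continuous_snd 2 _ _))

theorem convex_feasible (hX : Convex ℝ X) (hY : Convex ℝ Y) : Convex ℝ (feasible X Y) :=
  fun _ hz _ hz' _ _ ha hb hab =>
    ⟨hX hz.1 hz'.1 ha hb hab, hY hz.2 hz'.2 ha hb hab⟩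

/-- The vector is G(z) minus the proximal map at z. The latter's negative is normal to the product,
and varying one coordinate at a time makes each component normal to its factor. -/
theorem smul_sub_mem_constrainedSubdiff {G : Pair p q → Pair p q} {f : Vec p → Vec q → ℝ}
    {γ : ℝ} {w z : Pair p q} (hz : IsSVISolution (proxMap G γ w) (feasible X Y) z)
    (hf : G z ∈ saddleMap f z) : γ⁻¹ • (w - z) ∈ constrainedSubdiff f X Y z := by
  have hν := hz.neg_mem_normalCone
  constructor
  · have h : (γ⁻¹ • (w - z)).fst = (G z).fst + (-proxMap G γ w z).fst := by
      simp only [proxMap, WithLp.smul_fst, WithLp.sub_fst, WithLp.neg_fst, WithLp.add_fst]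
      module
    rw [h]
    refine add_mem_frechetSubdiff_indicatorTop hf.1 ⟨hz.1.1, fun x hx => ?_⟩
    have := hν.2 (WithLp.toLp 2 (x, z.snd)) ⟨hx, hz.1.2⟩
    simpa [WithLp.prod_inner_apply] using this
  · have h : (γ⁻¹ • (w - z)).snd = (G z).snd + (-proxMap G γ w z).snd := by
      simp only [proxMap, WithLp.smul_snd, WithLp.sub_snd, WithLp.neg_snd, WithLp.add_snd]
      module
    rw [h]
    refine add_mem_frechetSubdiff_indicatorTop hf.2 ⟨hz.1.2, fun y hy => ?_⟩
    have := hν.2 (WithLp.toLp 2 (z.fst, y)) ⟨hz.1.1, hy⟩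
    simpa [WithLp.prod_inner_apply] using this

theorem infEDist_constrainedSubdiff_sq_le {G : Pair p q → Pair p q} {f : Vec p → Vec q → ℝ}
    {γ : ℝ} (hγ : 0 < γ) {w z : Pair p q} (hz : IsSVISolution (proxMap G γ w) (feasible X Y) z)
    (hf : G z ∈ saddleMap f z) :
    Metric.infEDist 0 (constrainedSubdiff f X Y z) ^ 2 ≤
      ENNReal.ofReal ((γ ^ 2)⁻¹) * ENNReal.ofReal (‖w - z‖ ^ 2) := by
  have h := Metric.infEDist_le_edist_of_mem (x := 0) (smul_sub_mem_constrainedSubdiff hz hf)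
  refine (pow_le_pow_left' h 2).trans_eq ?_
  rw [edist_comm, edist_dist, dist_zero_right, ← ENNReal.ofReal_pow (norm_nonneg _),
    ← ENNReal.ofReal_mul (by positivity), norm_smul, Real.norm_of_nonneg (inv_pos.2 hγ).le, mul_pow,
    inv_pow]

theorem expect_mono {Ω : Type} {P : PMF Ω} {g g' : Ω → ℝ≥0∞} (h : ∀ o ∈ P.support, g o ≤ g' o) :
    expect P g ≤ expect P g' := by
  refine ENNReal.tsum_le_tsum fun o => ?_
  by_cases ho : P o = 0
  · simp [ho]
  · exact mul_le_mul_right (h o ((P.mem_support_iff o).2 ho)) _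

theorem expect_const_mul {Ω : Type} (P : PMF Ω) (c : ℝ≥0∞) (g : Ω → ℝ≥0∞) :
    expect P (fun o => c * g o) = c * expect P g := by
  simp only [expect, ← ENNReal.tsum_mul_left, mul_left_comm]

end

end IPP

end

theorem corollary5 (α : ℝ) (hα : 1 < α) :
    ∃ C : ℝ, 0 < C ∧
      ∀ (p q n : ℕ) [NeZero n] (X : Set (IPP.Vec p)) (Y : Set (IPP.Vec q))
        (F : Fin n → IPP.Pair p q → IPP.Pair p q) (ρ L D ε : ℝ),
        0 < ρ → ρ ≤ L → 0 < D → 0 < ε →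
        Convex ℝ X → Convex ℝ Y → IsCompact X → IsCompact Y →
        (∀ z ∈ IPP.feasible X Y, ∀ z' ∈ IPP.feasible X Y, ‖z - z'‖ ≤ D) →
        (∀ i, ∀ z ∈ IPP.feasible X Y, ∀ z' ∈ IPP.feasible X Y, ‖F i z - F i z'‖ ≤ L * ‖z - z'‖) →
        IPP.WeaklyMonotoneOn ρ (IPP.avg F) (IPP.feasible X Y) →
        (∃ zs, IPP.IsMVISolution (IPP.avg F) (IPP.feasible X Y) zs) →
        ∀ (z0 : IPP.Pair p q), z0 ∈ IPP.feasible X Y →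
        ∀ (ref : ℕ → IPP.Pair p q → IPP.Pair p q)
          (γ : ℝ) (K : ℕ) [NeZero K] (T : ℕ → ℕ) (P : PMF (IPP.Pair p q × ℕ)),
          γ = 1 / (2 * ρ) →
          K = ⌈6 * D ^ 2 * (α + 1) / ε ^ 2⌉₊ →
          (∀ k, T k = ⌈(1 - √3 / 2)⁻¹ * Real.log ((2 + √2) * L * (k + 1) / ρ)⌉₊) →
          P = (IPP.ippSVRG (n := n) (IPP.feasible X Y) γ ρ L T (IPP.stageLaw α K) ref z0).run F →
          (∀ o ∈ P.support, o.1 ∈ IPP.feasible X Y) ∧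
          (∃ bar : IPP.Pair p q → IPP.Pair p q,
            (∀ w ∈ IPP.feasible X Y, ∀ z,
              IPP.IsSVISolution (IPP.proxMap (IPP.avg F) γ w) (IPP.feasible X Y) z ↔ z = bar w) ∧
            IPP.expect P (fun o => ‖o.1 - bar o.1‖ₑ ^ 2) ≤ ENNReal.ofReal (ε ^ 2) ∧
            (∀ f : IPP.Vec p → IPP.Vec q → ℝ,
              (∀ z ∈ IPP.feasible X Y, IPP.saddleMap f z = {IPP.avg F z}) →
              IPP.expect P
                  (fun o => Metric.infEDist 0 (IPP.constrainedSubdiff f X Y (bar o.1)) ^ 2)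
                ≤ ENNReal.ofReal (ε ^ 2 / γ ^ 2))) ∧
          (ε ≤ D → ∀ o ∈ P.support,
            (o.2 : ℝ) ≤ C * (D ^ 2 * (n + L ^ 2 / ρ ^ 2) / ε ^ 2)
              * (1 + Real.log (L / ρ) + Real.log (D / ε))) := by

  refine ⟨IPP.complexityConst α, IPP.complexityConst_pos hα, ?_⟩
  intro p q n _ X Y F ρ L D ε hρ hρL hD hε hXcv hYcv hXc hYc hdiam hlip hmono ⟨zs, hzs⟩ z0 hz0 ref
    γ K _ T P hγ hK hT hP
  have hγ0 : 0 < γ := by rw [hγ]; positivity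
  have hγi : γ⁻¹ = 2 * ρ := by rw [hγ, one_div, inv_inv]
  have hργ : ρ < γ⁻¹ := by rw [hγi]; linarith
  have hL : 0 ≤ L := hρ.le.trans hρL
  have hcl := IPP.isClosed_feasible hXc.isClosed hYc.isClosed
  have hcv := IPP.convex_feasible hXcv hYcv
  choose bar hbar using
    IPP.exists_proxMap_solution ⟨z0, hz0⟩ hcl hcv hγ0 hργ hL hmono hlip
  have hbar' := fun w => (hbar w (bar w)).2 rfl
  have hpost := (IPP.post_ippSVRG (F := F) hcl hcv hγ0 hργ hL T
    (IPP.stageLaw α K) ref hz0).of_mem_support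
  rw [← hP] at hpost
  have hmean := IPP.mean_ippSVRG_le (K := K) (T := T) hα hcl hcv hρ hρL hγ0 hργ hdiam hlip hmono hzs
    (fun w _ => hbar' w) (fun k => (Nat.le_ceil _).trans_eq (by rw [hT k])) ref hz0
  -- The constant 6 in K exceeds the 4 that is required.
  have hle : 4 * (α + 1) * D ^ 2 / K ≤ ε ^ 2 := by
    have hK0 : (0 : ℝ) < K := Nat.cast_pos.2 (NeZero.pos K)
    have h1 : 6 * D ^ 2 * (α + 1) / ε ^ 2 ≤ K := (Nat.le_ceil _).trans_eq (by rw [← hK])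
    rw [div_le_iff₀ (by positivity)] at h1
    rw [div_le_iff₀ hK0]
    nlinarith [mul_pos (pow_pos hD 2) (by linarith : 0 < α + 1)]
  have hexp : IPP.expect P (fun o => ENNReal.ofReal (‖o.1 - bar o.1‖ ^ 2)) ≤
      ENNReal.ofReal (ε ^ 2) := by
    rw [hP, IPP.Prog.expect_run _ (g := fun z => ‖z - bar z‖ ^ 2) fun z => sq_nonneg _]
    exact ENNReal.ofReal_le_ofReal (hmean.trans hle)
  refine ⟨fun o ho => (hpost o ho).1, ⟨bar, fun w _ z => hbar w z, ?_, fun f hf => ?_⟩,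
    fun hεD o ho => ?_⟩
  · refine le_of_eq_of_le ?_ hexp
    simp only [ENNReal.ofReal_pow (norm_nonneg _), ofReal_norm]
  · have hmem : ∀ w, IPP.avg F (bar w) ∈ IPP.saddleMap f (bar w) := fun w =>
      (hf _ (hbar' w).1).symm ▸ Set.mem_singleton (IPP.avg F (bar w))
    have hdist := IPP.expect_mono (P := P) fun o _ =>
      IPP.infEDist_constrainedSubdiff_sq_le hγ0 (hbar' o.1) (hmem (o.1))
    refine hdist.trans ?_
    rw [IPP.expect_const_mul, div_eq_inv_mul, ENNReal.ofReal_mul (by positivity)]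
    exact mul_le_mul_right hexp _
  · rw [(hpost o ho).2, hγi, show 2 * ρ - ρ = ρ by ring]
    exact IPP.query_count_le hα hρ hρL hε hεD hK hT
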